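/- Let $X$ be a smooth manifold of dimension $n$, let $M\to X$ be the bundle of pseudo-Riemannian metrics of a fixed signature, let $J^2M\to J^1M$ be the bundles of 2-jets and 1-jets of its local sections, and let $p\ge 1$. For $x\in X$, let $N^2\subset S^2(T_xX)\otimes S^2(T_xX)$ be the kernel of the symmetrization in the last three indices. For $m\ge 1$, let $\mathrm{Div}_x^m\subset \bigotimes^p T_xX\otimes S^mN^2$ be the subspace of those tensors whose components satisfy $$T^{j_1\ldots j_p;\,a_1b_1c_1d_1\ldots a_mb_mc_md_m}+T^{j_1\ldots j_{p-1}d_1;\,a_1b_1j_pc_1\ldots a_mb_mc_md_m}+T^{j_1\ldots j_{p-1}c_1;\,a_1b_1d_1j_p\ldots a_mb_mc_md_m}=0 .$$ A second-order $p$-tensor is a smooth morphism of bundles $T\colon J^2M\to\bigotimes^pTX$ over $X$. It is natural if $T(\tau\cdot j^2_xg)=\tau_*T(j^2_xg)$ for every diffeomorphism $\tau\colon U\to V$ between open subsets of $X$ and every 2-jet $j^2_xg$ with $x\in U$. It is divergence-free if, for every local section $g$ of $M$, the tensor field $T(g)$ satisfies $\nabla_kT(g)^{j_1\ldots j_{p-1}k}=0$,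 where $\nabla$ is the Levi-Civita connection of $g$. **Theorem.** If $m\ge 1$ and $m\geq n/2$, then $\mathrm{Div}_x^m=0$ for every $x \in X$. Moreover, every divergence-free natural second-order $p$-tensor $T\colon J^2M\to\bigotimes^pTX$ is polynomial in the second derivatives $g_{ab,cd}$ of the metric, of degree at most $(n-1)/2$; that is, its restriction to every fibre of the affine bundle $J^2M\to J^1M$ is a polynomial map of degree at most $(n-1)/2$. -/

import Mathlib

open scoped Manifold ContDiff Topology

noncomputable section

namespace NaturalTensors

/-! ### Tensors at a point and the spaces `Div` -/

section Algebra

variable {V W : Type*} [AddCommGroup V] [Module ℝ V] [AddCommGroup W] [Module ℝ W]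

/-- Contravariant tensors on `V` with indices labelled by `ι`, as multilinear functions of
covectors. (Only finite-dimensional `V` and finite `ι` occur.) -/
abbrev Tensor (ι : Type*) (V : Type*) [AddCommGroup V] [Module ℝ V] : Type _ :=
  MultilinearMap ℝ (fun _ : ι => Module.Dual ℝ V) ℝ

/-- The tensor induced by a linear map `L : V → W`. -/
def Tensor.push {ι : Type*} (L : V →ₗ[ℝ] W) (T : Tensor ι V) : Tensor ι W :=
  T.compLinearMap fun _ => L.dualMap

/-- A four-index array of values `G (a, b, c, d)` has the symmetries of the space `N²` of
contravariant normal tensors: it lies in `S² ⊗ S²`, and it is in the kernel of the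
symmetrization over its last three indices. As `G` is symmetric in its last two indices, the
sum over the six permutations is twice the cyclic sum written here. -/
structure IsNormal {A : Type*} (G : (Fin 4 → A) → ℝ) : Prop where
  symm_left : ∀ a b c d, G ![a, b, c, d] = G ![b, a, c, d]
  symm_right : ∀ a b c d, G ![a, b, c, d] = G ![a, b, d, c]
  cyclic : ∀ a b c d, G ![a, b, c, d] + G ![a, c, d, b] + G ![a, d, b, c] = 0

/-- The value `T^{α ; β₁ β₂ …}` of a tensor with `p` free indices and `m` blocks of four indices,
the `i`-th block being evaluated on the covectors `β i 0, β i 1, β i 2, β i 3`. -/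
def blockEval {p m : ℕ} (T : Tensor (Fin p ⊕ Fin m × Fin 4) V)
    (α : Fin p → Module.Dual ℝ V) (β : Fin m → Fin 4 → Module.Dual ℝ V) : ℝ :=
  T (Sum.elim α fun ib => β ib.1 ib.2)

/-- The space `⊗^p V ⊗ S^m N²`, as a subspace of `⊗^(p + 4 m) V`: the tensors which are normal in
each of the `m` blocks of four indices, and symmetric under permutations of the blocks. -/
def derivativeSpace (p m : ℕ) (V : Type*) [AddCommGroup V] [Module ℝ V] :
    Submodule ℝ (Tensor (Fin p ⊕ Fin m × Fin 4) V) where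
  carrier := {T |
    (∀ α β i, IsNormal fun w : Fin 4 → Module.Dual ℝ V =>
      blockEval T α (Function.update β i w)) ∧
    (∀ α β (σ : Equiv.Perm (Fin m)), blockEval T α (β ∘ σ) = blockEval T α β)}
  zero_mem' := by
    refine ⟨fun α β i => ⟨?_, ?_, ?_⟩, ?_⟩ <;> intros <;> simp [blockEval]
  add_mem' := by
    rintro S T ⟨hS, hS'⟩ ⟨hT, hT'⟩
    have key : ∀ α β, blockEval (S + T) α β = blockEval S α β + blockEval T α β :=
      fun _ _ => rfl
    refine ⟨fun α β i => ⟨fun a b c d => ?_, fun a b c d => ?_, fun a b c d => ?_⟩,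
      fun α β σ => ?_⟩
    · have h1 := (hS α β i).symm_left a b c d
      have h2 := (hT α β i).symm_left a b c d
      simp only [key] at *
      linarith
    · have h1 := (hS α β i).symm_right a b c d
      have h2 := (hT α β i).symm_right a b c d
      simp only [key] at *
      linarith
    · have h1 := (hS α β i).cyclic a b c d
      have h2 := (hT α β i).cyclic a b c d
      simp only [key] at *
      linarith
    · rw [key, key, hS', hT']
  smul_mem' := by
    rintro r T ⟨hT, hT'⟩
    have key : ∀ α β, blockEval (r • T) α β = r * blockEval T α β := fun _ _ => rfl
    refine ⟨fun α β i => ⟨fun a b c d => ?_, fun a b c d => ?_, fun a b c d => ?_⟩,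
      fun α β σ => ?_⟩
    · simp only [key]
      rw [(hT α β i).symm_left a b c d]
    · simp only [key]
      rw [(hT α β i).symm_right a b c d]
    · simp only [key]
      rw [← mul_add, ← mul_add, (hT α β i).cyclic a b c d, mul_zero]
    · rw [key, key, hT']

/-- The subspace `Div^m` of `⊗^p V ⊗ S^m N²`, where `p = q + 1`: the tensors for which the sum
over the cyclic permutations of the three indices `(j_p, c₁, d₁)` vanishes. -/
def Div (q m : ℕ) (V : Type*) [AddCommGroup V] [Module ℝ V] :
    Submodule ℝ (Tensor (Fin (q + 1) ⊕ Fin m × Fin 4) V) where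
  carrier := {T | T ∈ derivativeSpace (q + 1) m V ∧
    ∀ (i : Fin m), (i : ℕ) = 0 → ∀ (α : Fin q → Module.Dual ℝ V) β (j a b c d),
      blockEval T (Fin.snoc α j) (Function.update β i ![a, b, c, d]) +
      blockEval T (Fin.snoc α d) (Function.update β i ![a, b, j, c]) +
      blockEval T (Fin.snoc α c) (Function.update β i ![a, b, d, j]) = 0}
  zero_mem' := ⟨Submodule.zero_mem _, fun _ _ _ _ _ _ _ _ _ => by simp [blockEval]⟩
  add_mem' := by
    rintro S T ⟨hS, hS'⟩ ⟨hT, hT'⟩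
    have key : ∀ α β, blockEval (S + T) α β = blockEval S α β + blockEval T α β :=
      fun _ _ => rfl
    refine ⟨Submodule.add_mem _ hS hT, fun i hi α β j a b c d => ?_⟩
    have h1 := hS' i hi α β j a b c d
    have h2 := hT' i hi α β j a b c d
    simp only [key]
    linarith
  smul_mem' := by
    rintro r T ⟨hT, hT'⟩
    have key : ∀ α β, blockEval (r • T) α β = r * blockEval T α β := fun _ _ => rfl
    refine ⟨Submodule.smul_mem _ r hT, fun i hi α β j a b c d => ?_⟩
    simp only [key]
    rw [← mul_add, ← mul_add, hT' i hi α β j a b c d, mul_zero]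

/-- A pseudo-Euclidean metric of signature `(r, s)`. -/
structure IsMetric (r s : ℕ) (b : LinearMap.BilinForm ℝ V) : Prop where
  symm : b.IsSymm
  nondegenerate : b.Nondegenerate
  sigPos_eq : sigPos (LinearMap.BilinMap.toQuadraticMap b) = r
  sigNeg_eq : sigNeg (LinearMap.BilinMap.toQuadraticMap b) = s

end Algebra

/-! ### Manifolds, charts and local metrics -/

/-- The model space of `n`-dimensional manifolds. -/
abbrev Model (n : ℕ) : Type := EuclideanSpace ℝ (Fin n)

/-- The partial derivative `∂_k f (y)`. -/
def partialDeriv {n : ℕ} (k : Fin n) (f : Model n → ℝ) (y : Model n) : ℝ :=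
  fderiv ℝ f y (EuclideanSpace.single k 1)

section Manifold

variable {n : ℕ} {X : Type*} [TopologicalSpace X] [ChartedSpace (Model n) X]

/-- `φ` is a smooth chart of `X`. -/
def IsChart (φ : OpenPartialHomeomorph X (Model n)) : Prop :=
  φ ∈ IsManifold.maximalAtlas 𝓘(ℝ, Model n) ∞ X

/-- The coordinate vector field `∂_a` of the chart `φ`, at the point of coordinates `y`. -/
def coordVector (φ : OpenPartialHomeomorph X (Model n)) (y : Model n) (a : Fin n) :
    TangentSpace 𝓘(ℝ, Model n) (φ.symm y) :=
  mfderiv 𝓘(ℝ, Model n) 𝓘(ℝ, Model n) φ.symm y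
    ((NormedSpace.fromTangentSpace (𝕜 := ℝ) y).symm (EuclideanSpace.single a 1))

/-- The coordinate covector `dx^j` of the chart `φ`, at the point `x`. -/
def coordCovector (φ : OpenPartialHomeomorph X (Model n)) (x : X) (j : Fin n) :
    Module.Dual ℝ (TangentSpace 𝓘(ℝ, Model n) x) :=
  ((EuclideanSpace.proj (𝕜 := ℝ) j).comp
    ((NormedSpace.fromTangentSpace (𝕜 := ℝ) (φ x)).toContinuousLinearMap.comp
      (mfderiv 𝓘(ℝ, Model n) 𝓘(ℝ, Model n) φ x))).toLinearMap

/-- The components `g_{ab}` in the chart `φ` of a field of bilinear forms, as functions of the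
coordinates. -/
def fieldComponents (φ : OpenPartialHomeomorph X (Model n))
    (g : ∀ x : X, LinearMap.BilinForm ℝ (TangentSpace 𝓘(ℝ, Model n) x))
    (a b : Fin n) (y : Model n) : ℝ :=
  g (φ.symm y) (coordVector φ y a) (coordVector φ y b)

variable (X) in
/-- Smooth local sections of the bundle `M → X` of pseudo-Riemannian metrics of signature `(r, s)`:
metrics defined on an open set `domain` (the values outside of it are irrelevant). -/
structure LocalMetric (r s : ℕ) where
  domain : Set X
  isOpen_domain : IsOpen domain
  form : ∀ x : X, LinearMap.BilinForm ℝ (TangentSpace 𝓘(ℝ, Model n) x)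
  isMetric : ∀ x ∈ domain, IsMetric r s (form x)
  smooth : ∀ φ : OpenPartialHomeomorph X (Model n), IsChart φ → ∀ a b,
    ContDiffOn ℝ ∞ (fieldComponents φ form a b) (φ.target ∩ φ.symm ⁻¹' domain)

variable {r s : ℕ}

/-- The components `g_{ab}` of a local metric in the chart `φ`. -/
def LocalMetric.comp (g : LocalMetric (n := n) X r s) (φ : OpenPartialHomeomorph X (Model n))
    (a b : Fin n) : Model n → ℝ :=
  fieldComponents φ g.form a b

/-- The components `g_{ab}` at a point of coordinates `y`. -/
def LocalMetric.coord₀ (g : LocalMetric (n := n) X r s)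
    (φ : OpenPartialHomeomorph X (Model n)) (y : Model n) : Fin n → Fin n → ℝ :=
  fun a b => g.comp φ a b y

/-- The first derivatives `g_{ab,c}` at a point of coordinates `y`. -/
def LocalMetric.coord₁ (g : LocalMetric (n := n) X r s)
    (φ : OpenPartialHomeomorph X (Model n)) (y : Model n) : Fin n → Fin n → Fin n → ℝ :=
  fun a b c => partialDeriv c (g.comp φ a b) y

/-- The second derivatives `g_{ab,cd}` at a point of coordinates `y`. -/
def LocalMetric.coord₂ (g : LocalMetric (n := n) X r s)
    (φ : OpenPartialHomeomorph X (Model n)) (y : Model n) :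
    Fin n → Fin n → Fin n → Fin n → ℝ :=
  fun a b c d => partialDeriv d (partialDeriv c (g.comp φ a b)) y

/-! ### The 2-jets of metrics -/

variable (r s) in
/-- Two metrics defined around `x` have the same 2-jet at `x` if, in every chart around `x`,
their components have the same derivatives of order at most two at `x`. -/
def jetSetoid (x : X) : Setoid {g : LocalMetric (n := n) X r s // x ∈ g.domain} where
  r g g' := ∀ φ : OpenPartialHomeomorph X (Model n), IsChart φ → x ∈ φ.source →
    g.1.coord₀ φ (φ x) = g'.1.coord₀ φ (φ x) ∧
    g.1.coord₁ φ (φ x) = g'.1.coord₁ φ (φ x) ∧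
    g.1.coord₂ φ (φ x) = g'.1.coord₂ φ (φ x)
  iseqv :=
    { refl := fun _ _ _ _ => ⟨rfl, rfl, rfl⟩
      symm := fun h φ hφ hx =>
        ⟨(h φ hφ hx).1.symm, (h φ hφ hx).2.1.symm, (h φ hφ hx).2.2.symm⟩
      trans := fun h h' φ hφ hx =>
        ⟨(h φ hφ hx).1.trans (h' φ hφ hx).1, (h φ hφ hx).2.1.trans (h' φ hφ hx).2.1,
          (h φ hφ hx).2.2.trans (h' φ hφ hx).2.2⟩ }

variable (r s) in
/-- The fibre over `x` of the bundle `J²M` of 2-jets of metrics of signature `(r, s)`. -/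
def Jet₂ (x : X) : Type _ := Quotient (jetSetoid (n := n) r s x)

/-- The 2-jet at `x` of a metric defined around `x`. -/
def LocalMetric.jet₂ (g : LocalMetric (n := n) X r s) (x : X) (hx : x ∈ g.domain) :
    Jet₂ (n := n) r s x :=
  Quotient.mk (jetSetoid r s x) ⟨g, hx⟩

/-! ### Second-order tensors -/

/-- The component `T^{j₁ … j_p}` in the chart `φ` of a tensor at the point `x`. -/
def tensorComponent {p : ℕ} {x : X}
    (T : Tensor (Fin p) (TangentSpace 𝓘(ℝ, Model n) x))
    (φ : OpenPartialHomeomorph X (Model n)) (J : Fin p → Fin n) : ℝ :=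
  T fun i => coordCovector φ x (J i)

/-- The coordinates `(x_i, g_{ab}, g_{ab,c}, g_{ab,cd})`. -/
abbrev JetCoord (n : ℕ) : Type :=
  Model n × (Fin n → Fin n → ℝ) × (Fin n → Fin n → Fin n → ℝ) ×
    (Fin n → Fin n → Fin n → Fin n → ℝ)

/-- The coordinates of the 2-jets of metrics of signature `(r, s)` at points of the domain of the
chart `φ`. -/
def jetCoordSet (r s : ℕ) (φ : OpenPartialHomeomorph X (Model n)) : Set (JetCoord n) :=
  {z | z.1 ∈ φ.target ∧
    IsMetric r s (Matrix.toBilin' (Matrix.of z.2.1)) ∧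
    (∀ a b c, z.2.2.1 a b c = z.2.2.1 b a c) ∧
    (∀ a b c d, z.2.2.2 a b c d = z.2.2.2 b a c d) ∧
    (∀ a b c d, z.2.2.2 a b c d = z.2.2.2 a b d c)}

variable (X) in
/-- Second-order `p`-tensors: smooth morphisms of bundles `T : J²M → ⊗^p TX` over `X`. Smoothness
means that, in any chart, the components are smooth functions
`T^{j₁ … j_p} (x_i, g_{ab}, g_{ab,c}, g_{ab,cd})`. -/
structure SecondOrderTensor (r s p : ℕ) where
  toFun : ∀ x : X, Jet₂ (n := n) r s x → Tensor (Fin p) (TangentSpace 𝓘(ℝ, Model n) x)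
  smooth : ∀ φ : OpenPartialHomeomorph X (Model n), IsChart φ → ∀ J : Fin p → Fin n,
    ∃ F : JetCoord n → ℝ, ContDiffOn ℝ ∞ F (jetCoordSet r s φ) ∧
      ∀ x ∈ φ.source, ∀ (g : LocalMetric X r s) (hx : x ∈ g.domain),
        tensorComponent (toFun x (g.jet₂ x hx)) φ J =
          F (φ x, g.coord₀ φ (φ x), g.coord₁ φ (φ x), g.coord₂ φ (φ x))

namespace SecondOrderTensor

variable {p : ℕ}

/-- `T` commutes with the diffeomorphisms `τ : U → V` between open sets of `X`:
`T (j²_{τ x} (τ_* g)) = τ_* (T (j²_x g))`. Here `g'` is any metric which coincides with `τ_* g`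
around `τ x`. -/
def IsNatural (T : SecondOrderTensor (n := n) X r s p) : Prop :=
  ∀ τ : OpenPartialHomeomorph X X,
    ContMDiffOn 𝓘(ℝ, Model n) 𝓘(ℝ, Model n) ∞ τ τ.source →
    ContMDiffOn 𝓘(ℝ, Model n) 𝓘(ℝ, Model n) ∞ τ.symm τ.target →
    ∀ (g g' : LocalMetric (n := n) X r s) (x : X) (hx : x ∈ g.domain)
      (hx' : τ x ∈ g'.domain), x ∈ τ.source →
      (∀ᶠ z in 𝓝 x, ∀ v w : TangentSpace 𝓘(ℝ, Model n) z,
        g'.form (τ z) (mfderiv 𝓘(ℝ, Model n) 𝓘(ℝ, Model n) τ z v)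
          (mfderiv 𝓘(ℝ, Model n) 𝓘(ℝ, Model n) τ z w) = g.form z v w) →
      T.toFun (τ x) (g'.jet₂ (τ x) hx') =
        Tensor.push (mfderiv 𝓘(ℝ, Model n) 𝓘(ℝ, Model n) τ x).toLinearMap
          (T.toFun x (g.jet₂ x hx))

open Classical in
/-- The components in the chart `φ` of the tensor field `T(g)`, as functions of the coordinates of
the points in the domain of `g` (with value `0` elsewhere). -/
def fieldComponent (T : SecondOrderTensor (n := n) X r s p) (g : LocalMetric (n := n) X r s)
    (φ : OpenPartialHomeomorph X (Model n)) (J : Fin p → Fin n) (y : Model n) : ℝ :=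
  if h : φ.symm y ∈ g.domain then
    tensorComponent (T.toFun (φ.symm y) (g.jet₂ (φ.symm y) h)) φ J
  else 0

end SecondOrderTensor

/-! ### Divergence -/

/-- The Christoffel symbols `Γ^i_{jk} = ½ g^{il} (g_{lk,j} + g_{lj,k} - g_{jk,l})`. -/
def LocalMetric.christoffel (g : LocalMetric (n := n) X r s)
    (φ : OpenPartialHomeomorph X (Model n)) (y : Model n) (i j k : Fin n) : ℝ :=
  (1 / 2) * ∑ l, (Matrix.of (g.coord₀ φ y))⁻¹ i l *
    (g.coord₁ φ y l k j + g.coord₁ φ y l j k - g.coord₁ φ y j k l)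

/-- The components `∇_k A^{J}` of the covariant derivative of a contravariant tensor field with
components `A^{J}` in the chart `φ`, with respect to the Levi-Civita connection of `g`. -/
def LocalMetric.covDeriv {p : ℕ} (g : LocalMetric (n := n) X r s)
    (φ : OpenPartialHomeomorph X (Model n)) (A : (Fin p → Fin n) → Model n → ℝ)
    (k : Fin n) (J : Fin p → Fin n) (y : Model n) : ℝ :=
  partialDeriv k (A J) y +
    ∑ i, ∑ l, g.christoffel φ y (J i) k l * A (Function.update J i l) y

/-- The components `(div T)(g)^{j₁ … j_{p-1}} = ∇_k T(g)^{j₁ … j_{p-1} k}` of the divergence of a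
second-order `p`-tensor, `p = q + 1`. -/
def SecondOrderTensor.divergence {q : ℕ} (T : SecondOrderTensor (n := n) X r s (q + 1))
    (g : LocalMetric (n := n) X r s) (φ : OpenPartialHomeomorph X (Model n))
    (J : Fin q → Fin n) (y : Model n) : ℝ :=
  ∑ k, g.covDeriv φ (T.fieldComponent g φ) k (Fin.snoc J k) y

/-- `div T = 0`: for every metric `g`, the divergence of `T(g)` is zero on the domain of `g`. -/
def SecondOrderTensor.IsDivergenceFree {q : ℕ}
    (T : SecondOrderTensor (n := n) X r s (q + 1)) : Prop :=
  ∀ φ : OpenPartialHomeomorph X (Model n), IsChart φ → ∀ g : LocalMetric (n := n) X r s,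
    ∀ x ∈ φ.source, x ∈ g.domain → ∀ J, T.divergence g φ J (φ x) = 0

/-! ### Polynomial tensors -/

/-- `T` is polynomial in the second derivatives of the metric, of degree at most `d`: on the fibre
of `J²M → J¹M` over the 1-jet at `x` of any metric `g₀`, and for any chart `φ` around `x`, the
components of `T` are polynomials of degree at most `d` in the coordinates `g_{ab,cd}`. -/
def SecondOrderTensor.IsPolynomialOfDegreeLE {p : ℕ}
    (T : SecondOrderTensor (n := n) X r s p) (d : ℝ) : Prop :=
  ∀ φ : OpenPartialHomeomorph X (Model n), IsChart φ → ∀ x ∈ φ.source,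
    ∀ g₀ : LocalMetric (n := n) X r s, x ∈ g₀.domain → ∀ J : Fin p → Fin n,
      ∃ P : MvPolynomial (Fin n × Fin n × Fin n × Fin n) ℝ, (P.totalDegree : ℝ) ≤ d ∧
        ∀ (g : LocalMetric (n := n) X r s) (hx : x ∈ g.domain),
          g.coord₀ φ (φ x) = g₀.coord₀ φ (φ x) → g.coord₁ φ (φ x) = g₀.coord₁ φ (φ x) →
          tensorComponent (T.toFun x (g.jet₂ x hx)) φ J =
            MvPolynomial.eval (fun i => g.coord₂ φ (φ x) i.1 i.2.1 i.2.2.1 i.2.2.2) P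

end Manifold

end NaturalTensors

end

/-!
# Divergence-free natural tensors of second order are polynomial

**Vanishing of `Div`.** An element `T` of `⊗^p V ⊗ S^m N²` is determined by its values
`T(α, j; y₁ y₁ z₁ z₁ … y_m y_m z_m z_m)`, by polarization (`eq_zero_of_blockEval_squareBlocks`).
If `T` is in `Div`, the cyclic condition gives `T(α, z_i; …) = 0`, and the symmetry of `N²` under
the exchange of its two pairs of indices gives `T(α, y_i; …) = 0` as well. So, as a functional of
the last free index `j`, this value is killed by the `2 m` covectors `y_i`, `z_i`, which generically
span the dual space when `2 m ≥ n`; hence it is zero (`eq_zero_of_annihilates_family`).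

**Polynomiality.** In a chart, the components of `T` are functions of `(x, g, ∂g, ∂²g)`.
* Naturality under the diffeomorphisms `y ↦ y + ℓ(y)³ v`, whose 2-jet at the origin is the identity,
  shows that `T` is invariant under the translations of `g_{ab,cd}` by
  `(μ_a ℓ_b + ℓ_a μ_b) ℓ_c ℓ_d`; infinitesimally, the derivatives of `T` along the fibre of
  `J²M → J¹M` take values in `N²` (`SecondOrderTensor.IsNatural.apply_jetOf_shearPullback`).
* The third derivatives `g_{ab,cdk}` enter the divergence linearly, with coefficients
  `∂T^{… k} / ∂g_{ab,cd}`; as they are arbitrary, `div T = 0` forces the cyclic sum of these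
  coefficients over `(k, c, d)` to vanish
  (`SecondOrderTensor.IsDivergenceFree.sum_fderivWithin_eq_zero`).

Thus the `m`-th derivatives of `T` along the fibre have the symmetries of `Div^m`, and vanish for
`2 m ≥ n` by the same generic spanning argument (`exists_mvPolynomial_of_symmetries`). A function
with vanishing derivatives of order `m` is a polynomial of degree less than `m`, and the smallest
admissible `m` gives the bound `(n - 1) / 2`.
-/

noncomputable section

namespace NaturalTensors

/-! ### Vanishing on generic families of vectors -/

/-- A functional depending polynomially on a family `w` of at least `dim E` vectors and
annihilating each of these vectors is zero: it is zero as soon as the family spans `E`, which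
holds on a dense set of parameters. Polynomial dependence enters only through continuity along
lines. -/
theorem eq_zero_of_annihilates_family {ι E : Type*} [Fintype ι] [AddCommGroup E] [Module ℝ E]
    [FiniteDimensional ℝ E] (hι : Module.finrank ℝ E ≤ Fintype.card ι)
    (Θ : (ι → E) → Module.Dual ℝ E) (hΘ : ∀ w i, Θ w (w i) = 0)
    (hc : ∀ w w' e, Continuous fun s : ℝ => Θ (w + s • w') e) (w : ι → E) : Θ w = 0 := by
  classical
  -- Perturb `w` along a family `w'` containing a basis: `w + s • w'` spans `E` unless `-s` is an
  -- eigenvalue of the matrix `A` of the corresponding vectors of `w`.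
  set b := Module.finBasis ℝ E
  obtain ⟨emb⟩ : Nonempty (Fin (Module.finrank ℝ E) ↪ ι) :=
    Function.Embedding.nonempty_of_card_le (by simpa using hι)
  set w' : ι → E := Function.extend emb b 0
  have hw' : ∀ k, w' (emb k) = b k := fun k => emb.injective.extend_apply _ _ k
  set A := b.toMatrix (w ∘ emb)
  have hfin : {s : ℝ | (-A).charpoly.eval s = 0}.Finite := by
    refine ((-A).charpoly.roots.toFinset.finite_toSet).subset fun s hs => ?_
    simpa [(-A).charpoly_monic.ne_zero] using hs
  have hmat : ∀ s : ℝ, b.toMatrix (fun k => (w + s • w') (emb k)) = Matrix.scalar _ s - -A := by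
    intro s
    ext i j
    simp [Module.Basis.toMatrix_apply, A, hw', Matrix.diagonal_apply, Finsupp.single_apply,
      eq_comm, add_comm]
  have hzero : ∀ s ∈ {s : ℝ | (-A).charpoly.eval s = 0}ᶜ, Θ (w + s • w') = 0 := by
    intro s hs
    have hdet : IsUnit (b.det fun k => (w + s • w') (emb k)) := by
      rw [Module.Basis.det_apply, hmat, ← Matrix.eval_charpoly]
      exact isUnit_iff_ne_zero.mpr hs
    obtain ⟨-, hspan⟩ := (Module.Basis.is_basis_iff_det b).mpr hdet
    refine LinearMap.ext_on_range hspan fun k => ?_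
    simpa using hΘ (w + s • w') (emb k)
  ext e
  have := Continuous.ext_on (hfin.countable.dense_compl ℝ) (hc w w' e)
    (continuous_const (y := (0 : ℝ))) fun s hs => by simp [hzero s hs]
  simpa using congrFun this 0

/-- No topology on `E` is needed: the restriction of `T` to a line is a polynomial. -/
theorem continuous_multilinear_line {ι E : Type*} [Fintype ι] [AddCommGroup E] [Module ℝ E]
    (T : MultilinearMap ℝ (fun _ : ι => E) ℝ) (v w : ι → E) :
    Continuous fun s : ℝ => T (v + s • w) := by
  classical
  have h : ∀ s : ℝ, T (v + s • w) =
      ∑ S : Finset ι, (∏ i, if i ∈ S then 1 else s) * T (S.piecewise v w) := by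
    intro s
    rw [MultilinearMap.map_add_univ]
    refine Finset.sum_congr rfl fun S _ => ?_
    rw [← smul_eq_mul, ← MultilinearMap.map_smul_univ]
    congr 1
    ext i
    by_cases hi : i ∈ S <;> simp [hi]
  simp_rw [h]
  refine continuous_finsetSum _ fun S _ => Continuous.mul ?_ continuous_const
  refine continuous_finsetProd _ fun i _ => ?_
  change Continuous fun s : ℝ => if i ∈ S then 1 else s
  by_cases hi : i ∈ S <;> simp only [hi, if_true, if_false] <;> fun_prop

/-! ### Vanishing of `Div` -/

/-- Arrays in `N²` are also symmetric under the exchange of the two pairs of indices. -/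
theorem IsNormal.pair_symm {A : Type*} {G : (Fin 4 → A) → ℝ} (hG : IsNormal G) (a b c d : A) :
    G ![a, b, c, d] = G ![c, d, a, b] := by
  have h1 := hG.cyclic a b c d
  have h2 := hG.cyclic b a c d
  have h3 := hG.cyclic c d a b
  have h4 := hG.cyclic d c a b
  linarith [hG.symm_left a b c d, hG.symm_left a c d b, hG.symm_left a d b c,
    hG.symm_left b c d a, hG.symm_left b d a c, hG.symm_left c d a b,
    hG.symm_right a b c d, hG.symm_right a c d b, hG.symm_right a d b c,
    hG.symm_right b c d a, hG.symm_right b d a c, hG.symm_right c d a b,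
    hG.symm_right d a b c, hG.symm_right c a b d,hG.symm_right d b c a, hG.symm_right c b d a,
    hG.symm_left d a b c, hG.symm_left c a b d,hG.symm_left d b c a, hG.symm_left c b d a]

section Div

variable {V : Type*} [AddCommGroup V] [Module ℝ V] {q m : ℕ}

theorem exists_perm_apply_eq_zero (i : Fin m) :
    ∃ (σ : Equiv.Perm (Fin m)) (o : Fin m), (o : ℕ) = 0 ∧ σ o = i :=
  ⟨Equiv.swap i ⟨0, i.pos⟩, ⟨0, i.pos⟩, rfl, Equiv.swap_apply_right _ _⟩

/-- By symmetry, the cyclic condition defining `Div` holds for every block. -/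
theorem Div.cyclic {T : Tensor (Fin (q + 1) ⊕ Fin m × Fin 4) V} (hT : T ∈ Div q m V)
    (i : Fin m) (α : Fin q → Module.Dual ℝ V) (β : Fin m → Fin 4 → Module.Dual ℝ V)
    (j a b c d : Module.Dual ℝ V) :
    blockEval T (Fin.snoc α j) (Function.update β i ![a, b, c, d]) +
      blockEval T (Fin.snoc α d) (Function.update β i ![a, b, j, c]) +
      blockEval T (Fin.snoc α c) (Function.update β i ![a, b, d, j]) = 0 := by
  obtain ⟨σ, o, ho, rfl⟩ := exists_perm_apply_eq_zero i
  have key : ∀ α' w, blockEval T α' (Function.update β (σ o) w) =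
      blockEval T α' (Function.update (β ∘ σ) o w) := by
    intro α' w
    rw [← hT.1.2 α' _ σ, Function.update_comp_eq_of_injective _ σ.injective]
  simp only [key]
  exact hT.2 o ho α (β ∘ σ) j a b c d

variable (m) in
/-- The blocks `y_i y_i z_i z_i` of covectors, where `y` and `z` are the two halves of `w`. -/
def squareBlocks {E : Type*} (w : Fin m ⊕ Fin m → E) : Fin m → Fin 4 → E :=
  fun i => ![w (.inl i), w (.inl i), w (.inr i), w (.inr i)]

/-- With three equal indices, the cyclic condition has three equal terms. -/
theorem Div.blockEval_squareBlocks_inr {T : Tensor (Fin (q + 1) ⊕ Fin m × Fin 4) V}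
    (hT : T ∈ Div q m V) (α : Fin q → Module.Dual ℝ V) (w : Fin m ⊕ Fin m → Module.Dual ℝ V)
    (i : Fin m) : blockEval T (Fin.snoc α (w (.inr i))) (squareBlocks m w) = 0 := by
  have h := Div.cyclic hT i α (squareBlocks m w) (w (.inr i)) (w (.inl i)) (w (.inl i))
    (w (.inr i)) (w (.inr i))
  rw [show ![w (.inl i), w (.inl i), w (.inr i), w (.inr i)] = squareBlocks m w i from rfl,
    Function.update_eq_self] at h
  linarith

/-- The exchange of the two pairs of the block `i` reduces this to the case of three equal indices
in the cyclic condition. -/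
theorem Div.blockEval_squareBlocks_inl {T : Tensor (Fin (q + 1) ⊕ Fin m × Fin 4) V}
    (hT : T ∈ Div q m V) (α : Fin q → Module.Dual ℝ V) (w : Fin m ⊕ Fin m → Module.Dual ℝ V)
    (i : Fin m) : blockEval T (Fin.snoc α (w (.inl i))) (squareBlocks m w) = 0 := by
  have h := Div.cyclic hT i α (squareBlocks m w) (w (.inl i)) (w (.inr i)) (w (.inr i))
    (w (.inl i)) (w (.inl i))
  have hs := (hT.1.1 (Fin.snoc α (w (.inl i))) (squareBlocks m w) i).pair_symm
    (w (.inr i)) (w (.inr i)) (w (.inl i)) (w (.inl i))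
  rw [show ![w (.inl i), w (.inl i), w (.inr i), w (.inr i)] = squareBlocks m w i from rfl,
    Function.update_eq_self] at hs
  linarith

/-- On square blocks, the last free index of a tensor in `Div` is killed by `2 m` generic
covectors, which span the dual space if `2 m ≥ n`. -/
theorem Div.blockEval_squareBlocks [FiniteDimensional ℝ V] (hm : Module.finrank ℝ V ≤ 2 * m)
    {T : Tensor (Fin (q + 1) ⊕ Fin m × Fin 4) V} (hT : T ∈ Div q m V)
    (α : Fin q → Module.Dual ℝ V) (j : Module.Dual ℝ V) (w : Fin m ⊕ Fin m → Module.Dual ℝ V) :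
    blockEval T (Fin.snoc α j) (squareBlocks m w) = 0 := by
  classical
  have hupd : ∀ (w : Fin m ⊕ Fin m → Module.Dual ℝ V) (x : Module.Dual ℝ V),
      (Sum.elim (Fin.snoc α x : Fin (q + 1) → Module.Dual ℝ V)
        fun ib : Fin m × Fin 4 => squareBlocks m w ib.1 ib.2) =
      Function.update (Sum.elim (Fin.snoc α 0 : Fin (q + 1) → Module.Dual ℝ V)
        fun ib : Fin m × Fin 4 => squareBlocks m w ib.1 ib.2) (.inl (Fin.last q)) x := by
    intro w x
    rw [Sum.update_elim_inl, Fin.update_snoc_last]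
  let Θ : (Fin m ⊕ Fin m → Module.Dual ℝ V) → Module.Dual ℝ (Module.Dual ℝ V) := fun w =>
    T.toLinearMap (Sum.elim (Fin.snoc α 0 : Fin (q + 1) → Module.Dual ℝ V)
        fun ib : Fin m × Fin 4 => squareBlocks m w ib.1 ib.2) (.inl (Fin.last q))
  have hΘ : ∀ w x, Θ w x = blockEval T (Fin.snoc α x) (squareBlocks m w) := by
    intro w x
    rw [blockEval, hupd]
    rfl
  have := eq_zero_of_annihilates_family (E := Module.Dual ℝ V) (ι := Fin m ⊕ Fin m)
    (by rw [Subspace.dual_finrank_eq]; simpa [two_mul] using hm) Θ ?_ ?_ w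
  · rw [← hΘ, this]; rfl
  · rintro w (i | i) <;> rw [hΘ]
    · exact Div.blockEval_squareBlocks_inl hT α w i
    · exact Div.blockEval_squareBlocks_inr hT α w i
  · intro w w' x
    simp only [hΘ, blockEval]
    convert! continuous_multilinear_line T
      (Sum.elim (Fin.snoc α x : Fin (q + 1) → Module.Dual ℝ V)
        fun ib : Fin m × Fin 4 => squareBlocks m w ib.1 ib.2)
      (Sum.elim 0 fun ib : Fin m × Fin 4 => squareBlocks m w' ib.1 ib.2) using 3 with s
    ext i v
    rcases i with i | ⟨i, b⟩
    · simp
    · fin_cases b <;> simp [squareBlocks]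

/-- Polarization: an element of `⊗^p V ⊗ S^m N²` is determined by its values on square blocks. -/
theorem eq_zero_of_blockEval_squareBlocks {p : ℕ} {T : Tensor (Fin p ⊕ Fin m × Fin 4) V}
    (hT : T ∈ derivativeSpace p m V)
    (h : ∀ α w, blockEval T α (squareBlocks m w) = 0) : T = 0 := by
  classical
  -- Polarize one block at a time: the blocks outside of `S` are still square.
  have key : ∀ (S : Finset (Fin m)) α (β : Fin m → Fin 4 → Module.Dual ℝ V),
      (∀ i ∉ S, ∃ y z, β i = ![y, y, z, z]) → blockEval T α β = 0 := by
    intro S α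
    induction S using Finset.induction_on with
    | empty =>
      intro β hβ
      choose y z hyz using fun i => hβ i (Finset.notMem_empty i)
      have : β = squareBlocks m (Sum.elim y z) := by
        ext1 i
        rw [hyz]
        rfl
      rw [this, h]
    | insert i S hi ih =>
      intro β hβ
      set G : (Fin 4 → Module.Dual ℝ V) → ℝ := fun w => blockEval T α (Function.update β i w)
      have hG : IsNormal G := hT.1 α β i
      have hsq : ∀ y z, G ![y, y, z, z] = 0 := by
        intro y z
        refine ih _ fun k hk => ?_
        rcases eq_or_ne k i with rfl | hki
        · exact ⟨y, z, by simp⟩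
        · obtain ⟨y', z', h'⟩ := hβ k (by simp [hki, hk])
          exact ⟨y', z', by simp [hki, h']⟩
      have hGadd : ∀ (w : Fin 4 → Module.Dual ℝ V) k x x', G (Function.update w k (x + x')) =
          G (Function.update w k x) + G (Function.update w k x') := by
        intro w k x x'
        have : ∀ x, (Sum.elim α fun ib : Fin m × Fin 4 =>
            Function.update β i (Function.update w k x) ib.1 ib.2) =
            Function.update (Sum.elim α fun ib : Fin m × Fin 4 =>
              Function.update β i w ib.1 ib.2) (.inr (i, k)) x := by
          intro x
          ext1 o
          rcases o with o | ⟨o, b⟩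
          · simp
          · by_cases ho : o = i
            · subst ho
              by_cases hb : b = k
              · subst hb; simp
              · simp [hb]
            · simp [ho]
        simp only [G, blockEval, this]
        exact T.map_update_add _ _ _ _
      have g0 : ∀ a a' b c d, G ![a + a', b, c, d] = G ![a, b, c, d] + G ![a', b, c, d] := by
        intro a a' b c d
        have hu : ∀ x, Function.update ![0, b, c, d] 0 x = ![x, b, c, d] := by
          intro x
          ext1 k
          fin_cases k <;> rfl
        simpa only [hu] using hGadd ![0, b, c, d] 0 a a'
      have g1 : ∀ a b b' c d, G ![a, b + b', c, d] = G ![a, b, c, d] + G ![a, b', c, d] := by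
        intro a b b' c d
        rw [hG.symm_left, g0, hG.symm_left b, hG.symm_left b']
      have g2 : ∀ a b c c' d, G ![a, b, c + c', d] = G ![a, b, c, d] + G ![a, b, c', d] := by
        intro a b c c' d
        rw [hG.pair_symm, g0, hG.pair_symm c, hG.pair_symm c']
      have g3 : ∀ a b c d d', G ![a, b, c, d + d'] = G ![a, b, c, d] + G ![a, b, c, d'] := by
        intro a b c d d'
        rw [hG.pair_symm, g1, hG.pair_symm c d, hG.pair_symm c d']
      have hleft : ∀ a b z, G ![a, b, z, z] = 0 := by
        intro a b z
        have h1 := hsq (a + b) z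
        rw [g0, g1, g1] at h1
        linarith [hsq a z, hsq b z, hG.symm_left a b z z]
      have hall : ∀ a b c d, G ![a, b, c, d] = 0 := by
        intro a b c d
        have h1 := hleft a b (c + d)
        rw [g2, g3, g3] at h1
        linarith [hleft a b c, hleft a b d, hG.symm_right a b c d]
      have h4 : β i = ![β i 0, β i 1, β i 2, β i 3] := by
        ext1 k
        fin_cases k <;> rfl
      have := hall (β i 0) (β i 1) (β i 2) (β i 3)
      rw [← h4] at this
      simpa [G] using this
  ext v
  have := key Finset.univ (fun i => v (.inl i)) (fun i b => v (.inr (i, b))) (by simp)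
  rw [blockEval] at this
  rw [zero_apply, ← this]
  congr 1
  ext1 o
  rcases o with o | ⟨o, b⟩ <;> rfl

/-- The vanishing of `Div^m` for `2 m ≥ n`. -/
theorem Div.eq_bot [FiniteDimensional ℝ V] (hm : Module.finrank ℝ V ≤ 2 * m) :
    Div q m V = ⊥ := by
  refine (Submodule.eq_bot_iff _).mpr fun T hT =>
    eq_zero_of_blockEval_squareBlocks hT.1 fun α w => ?_
  rw [← Fin.snoc_init_self α]
  exact Div.blockEval_squareBlocks hm hT _ _ w

end Div

/-! ### Iterated derivatives and polynomials -/

section IteratedDerivatives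

variable {E : Type*} [NormedAddCommGroup E] [NormedSpace ℝ E] {f : E → ℝ}

theorem contDiff_fderiv_apply (hf : ContDiff ℝ ∞ f) (w : E) :
    ContDiff ℝ ∞ fun u => fderiv ℝ f u w :=
  (hf.fderiv_right (m := ∞) le_rfl).clm_apply contDiff_const

theorem iteratedFDeriv_succ_apply_eq (hf : ContDiff ℝ ∞ f) (m : ℕ) (u : E)
    (w : Fin (m + 1) → E) :
    iteratedFDeriv ℝ (m + 1) f u w =
      iteratedFDeriv ℝ m (fun u => fderiv ℝ f u (w (Fin.last m))) u (Fin.init w) := by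
  rw [iteratedFDeriv_succ_apply_right]
  have h := ContinuousLinearMap.iteratedFDeriv_comp_left
    (ContinuousLinearMap.apply ℝ ℝ (w (Fin.last m))) (x := u) (i := m)
    (hf.fderiv_right (m := ∞) le_rfl).contDiffAt (by exact_mod_cast le_top)
  have h' := congrArg (fun M => M (Fin.init w)) h
  exact h'.symm

theorem fderiv_fderiv_apply_comm (hf : ContDiff ℝ ∞ f) (u v w : E) :
    fderiv ℝ (fun u => fderiv ℝ f u v) u w = fderiv ℝ (fun u => fderiv ℝ f u w) u v := by
  have hd : DifferentiableAt ℝ (fderiv ℝ f) u :=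
    ((hf.fderiv_right (m := ∞) le_rfl).differentiable (by simp)) u
  have key : ∀ v w, fderiv ℝ (fun u => fderiv ℝ f u v) u w = fderiv ℝ (fderiv ℝ f) u w v := by
    intro v w
    rw [fderiv_clm_apply hd (differentiableAt_const v)]
    simp
  rw [key, key]
  exact (hf.contDiffAt.isSymmSndFDerivAt 
    (by rw [minSmoothness_of_isRCLikeNormedField]; exact WithTop.coe_le_coe.2 le_top)) w v

/-- If the derivative of `f` in the direction `w₀` vanishes identically, so do the higher
derivatives having `w₀` among their directions. -/
theorem iteratedFDeriv_apply_eq_zero {w₀ : E} (m : ℕ) (hf : ContDiff ℝ ∞ f)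
    (h : ∀ u, fderiv ℝ f u w₀ = 0) (u : E) (w : Fin m → E) (i : Fin m) (hi : w i = w₀) :
    iteratedFDeriv ℝ m f u w = 0 := by
  induction m generalizing f with
  | zero => exact i.elim0
  | succ m ih =>
    rw [iteratedFDeriv_succ_apply_eq hf]
    induction i using Fin.lastCases with
    | last =>
      have : (fun u => fderiv ℝ f u (w (Fin.last m))) = 0 := by
        ext u
        rw [hi, h]; rfl
      rw [this]
      simp
    | cast i =>
      refine ih (contDiff_fderiv_apply hf _) (fun u => ?_) _ i hi
      rw [fderiv_fderiv_apply_comm hf]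
      simp [h]

/-- The version of `iteratedFDeriv_apply_eq_zero` for a linear combination of functions. -/
theorem sum_mul_iteratedFDeriv_apply_eq_zero {ι : Type*} [Fintype ι] {f : ι → E → ℝ} {w₀ : E}
    (m : ℕ) (hf : ∀ k, ContDiff ℝ ∞ (f k)) (x : ι → ℝ)
    (h : ∀ u, ∑ k, x k * fderiv ℝ (f k) u w₀ = 0) (u : E) (w : Fin m → E) (i : Fin m)
    (hi : w i = w₀) : ∑ k, x k * iteratedFDeriv ℝ m (f k) u w = 0 := by
  have hsum : ContDiff ℝ ∞ fun u => ∑ k, x k • f k u :=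
    ContDiff.sum fun k _ => (hf k).const_smul (x k)
  have hle : (m : WithTop ℕ∞) ≤ ∞ := by exact_mod_cast le_top
  have := iteratedFDeriv_apply_eq_zero m hsum (w₀ := w₀) (fun u => ?_) u w i hi
  · rw [iteratedFDeriv_fun_sum_apply fun k _ =>
      (((hf k).const_smul (x k)).of_le hle).contDiffAt] at this
    rw [← this, sum_apply]
    refine Finset.sum_congr rfl fun k _ => ?_
    rw [iteratedFDeriv_const_smul_apply' ((hf k).of_le hle).contDiffAt]
    simp
  · rw [← h u, fderiv_fun_sum fun k _ =>
      (((hf k).const_smul (x k)).differentiable (by simp)) u, sum_apply]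
    refine Finset.sum_congr rfl fun k _ => ?_
    rw [fderiv_fun_const_smul (((hf k).differentiable (by simp)) u)]
    simp

theorem eval_smul_of_isHomogeneous {ι : Type*} {P : MvPolynomial ι ℝ} {d : ℕ}
    (hP : P.IsHomogeneous d) (t : ℝ) (x : ι → ℝ) :
    MvPolynomial.eval (fun k => t * x k) P = t ^ d * MvPolynomial.eval x P := by
  rw [MvPolynomial.eval_eq, MvPolynomial.eval_eq, Finset.mul_sum]
  refine Finset.sum_congr rfl fun s hs => ?_
  have hd : s.degree = d := by
    rw [Finsupp.degree_eq_weight_one]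
    exact hP (MvPolynomial.mem_support_iff.mp hs)
  rw [Finsupp.degree_apply] at hd
  simp only [mul_pow, Finset.prod_mul_distrib, Finset.prod_pow_eq_pow_sum, hd]
  ring

/-- A function whose derivatives of order `m + 1` vanish is a polynomial of degree at most `m`
in the linear coordinates `c` of a basis `e`. -/
theorem exists_mvPolynomial_of_iteratedFDeriv_eq_zero {ι : Type*} [Fintype ι]
    (c : ι → E →L[ℝ] ℝ) (e : ι → E) (hce : ∀ u, ∑ i, c i u • e i = u) (m : ℕ)
    (hf : ContDiff ℝ ∞ f) (h : ∀ u w, iteratedFDeriv ℝ (m + 1) f u w = 0) :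
    ∃ P : MvPolynomial ι ℝ, P.totalDegree ≤ m ∧
      ∀ u, f u = MvPolynomial.eval (fun i => c i u) P := by
  induction m generalizing f with
  | zero =>
    refine ⟨MvPolynomial.C (f 0), by simp, fun u => ?_⟩
    rw [MvPolynomial.eval_C]
    refine is_const_of_fderiv_eq_zero (𝕜 := ℝ) (hf.differentiable (by simp)) (fun v => ?_) u 0
    ext w
    have := h v fun _ => w
    rw [iteratedFDeriv_succ_apply_eq hf] at this
    simpa using this
  | succ m ih =>
    have hP : ∀ i, ∃ P : MvPolynomial ι ℝ, P.totalDegree ≤ m ∧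
        ∀ u, fderiv ℝ f u (e i) = MvPolynomial.eval (fun i => c i u) P := by
      intro i
      refine ih (contDiff_fderiv_apply hf _) fun u w => ?_
      have := h u (Fin.snoc w (e i))
      rw [iteratedFDeriv_succ_apply_eq hf] at this
      simpa using this
    choose P hdeg hPe using hP
    -- the primitive of `∑ i, dxᵢ Pᵢ` along the rays from the origin
    set Q : MvPolynomial ι ℝ := MvPolynomial.C (f 0) + ∑ i, MvPolynomial.X i *
      ∑ d ∈ Finset.range (m + 1),
        MvPolynomial.C (1 / ((d : ℝ) + 1)) * MvPolynomial.homogeneousComponent d (P i)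
    refine ⟨Q, ?_, fun u => ?_⟩
    · refine (MvPolynomial.totalDegree_add _ _).trans (max_le (by simp) ?_)
      refine MvPolynomial.totalDegree_finsetSum_le fun i _ => ?_
      refine (MvPolynomial.totalDegree_mul _ _).trans ?_
      rw [MvPolynomial.totalDegree_X, add_comm]
      refine Nat.add_le_add_right (MvPolynomial.totalDegree_finsetSum_le fun d hd => ?_) 1
      refine (MvPolynomial.totalDegree_mul _ _).trans ?_
      rw [MvPolynomial.totalDegree_C, zero_add]
      have := (MvPolynomial.homogeneousComponent_isHomogeneous d (P i)).totalDegree_le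
      have := Finset.mem_range.mp hd
      omega
    · have hhom : ∀ i d (t : ℝ), MvPolynomial.eval (fun k => t * c k u)
          (MvPolynomial.homogeneousComponent d (P i)) =
          t ^ d * MvPolynomial.eval (fun k => c k u)
            (MvPolynomial.homogeneousComponent d (P i)) := by
        intro i d t
        exact eval_smul_of_isHomogeneous
          (MvPolynomial.homogeneousComponent_isHomogeneous d (P i)) t _
      have hQ : ∀ t : ℝ, MvPolynomial.eval (fun k => t * c k u) Q = f 0 + ∑ i, c i u *
          ∑ d ∈ Finset.range (m + 1), t ^ (d + 1) / ((d : ℝ) + 1) *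
            MvPolynomial.eval (fun k => c k u) (MvPolynomial.homogeneousComponent d (P i)) := by
        intro t
        simp only [Q, map_add, map_sum, map_mul, MvPolynomial.eval_C, MvPolynomial.eval_X, hhom,
          Finset.mul_sum]
        congr 1
        refine Finset.sum_congr rfl fun i _ => Finset.sum_congr rfl fun d _ => ?_
        ring
      have hPsum : ∀ i (t : ℝ), MvPolynomial.eval (fun k => t * c k u) (P i) =
          ∑ d ∈ Finset.range (m + 1), t ^ d *
            MvPolynomial.eval (fun k => c k u) (MvPolynomial.homogeneousComponent d (P i)) := by
        intro i t
        have hs : P i = ∑ d ∈ Finset.range (m + 1),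
            MvPolynomial.homogeneousComponent d (P i) := by
          rw [← Finset.sum_subset (Finset.range_mono (Nat.add_le_add_right (hdeg i) 1)),
            MvPolynomial.sum_homogeneousComponent]
          intro d _ hd
          exact MvPolynomial.homogeneousComponent_eq_zero _ _ (by simpa using hd)
        conv_lhs => rw [hs]
        simp only [map_sum, hhom]
      have hd : ∀ t : ℝ, HasDerivAt
          (fun t : ℝ => f (t • u) - MvPolynomial.eval (fun k => t * c k u) Q) 0 t := by
        intro t
        have h1 : HasDerivAt (fun t : ℝ => f (t • u)) (fderiv ℝ f (t • u) u) t := by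
          have := ((hf.differentiable (by simp)) (t • u)).hasFDerivAt.comp_hasDerivAt t
            ((hasDerivAt_id t).smul_const u)
          simp only [id, one_smul] at this
          exact this
        have h2 : HasDerivAt (fun t : ℝ => MvPolynomial.eval (fun k => t * c k u) Q)
            (∑ i, c i u * MvPolynomial.eval (fun k => t * c k u) (P i)) t := by
          simp only [hQ, hPsum]
          refine HasDerivAt.const_add _ (HasDerivAt.fun_sum fun i _ => HasDerivAt.const_mul _
            (HasDerivAt.fun_sum fun d _ => HasDerivAt.mul_const ?_ _))
          have := (hasDerivAt_pow (d + 1) t).div_const ((d : ℝ) + 1)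
          convert this using 1
          have : ((d : ℝ) + 1) ≠ 0 := by positivity
          push_cast
          field_simp
        have h3 := h1.sub h2
        have h4 : fderiv ℝ f (t • u) u =
            ∑ i, c i u * MvPolynomial.eval (fun k => t * c k u) (P i) := by
          conv_lhs => rw [← hce u, map_sum]
          rw [hce]
          refine Finset.sum_congr rfl fun i _ => ?_
          simp [hPe]
        rw [h4, sub_self] at h3
        exact h3
      have hconst := is_const_of_deriv_eq_zero (fun t => (hd t).differentiableAt)
        (fun t => (hd t).deriv) 1 0
      have h0 := hQ 0
      simp only [zero_smul, one_smul, one_mul] at hconst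
      rw [h0] at hconst
      simp only [ne_eq, Nat.add_eq_zero_iff, one_ne_zero, and_false, not_false_eq_true,
        zero_pow, zero_div, zero_mul, Finset.sum_const_zero, mul_zero, add_zero, sub_self] at hconst
      linarith

end IteratedDerivatives

theorem multilinear_eq_zero_of_span {E : Type*} [AddCommGroup E] [Module ℝ E] {m : ℕ}
    (M : MultilinearMap ℝ (fun _ : Fin m => E) ℝ) {Q : Set E} (hQ : Submodule.span ℝ Q = ⊤)
    (h : ∀ w : Fin m → E, (∀ i, w i ∈ Q) → M w = 0) : M = 0 := by
  have key : ∀ (S : Finset (Fin m)) (w : Fin m → E), (∀ i ∉ S, w i ∈ Q) → M w = 0 := by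
    intro S
    induction S using Finset.induction_on with
    | empty => exact fun w hw => h w fun i => hw i (Finset.notMem_empty i)
    | insert i S hi ih =>
      intro w hw
      have hker : (⊤ : Submodule ℝ E) ≤ LinearMap.ker (M.toLinearMap w i) := by
        rw [← hQ, Submodule.span_le]
        intro v hv
        refine ih _ fun k hk => ?_
        rcases eq_or_ne k i with rfl | hki
        · simpa using hv
        · simpa [hki] using hw k (by simp [hki, hk])
      simpa using hker (Submodule.mem_top (x := w i))
  ext w
  exact key Finset.univ w (by simp)

/-! ### Functions of the second derivatives of the metric -/

section Fibre

variable {n : ℕ}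

/-- Arrays `u_{abcd}`, the values of the second derivatives `g_{ab,cd}`. -/
abbrev Array₄ (n : ℕ) : Type := Fin n → Fin n → Fin n → Fin n → ℝ

/-- The symmetrization of `u_{abcd}` in `ab` and in `cd`. -/
def symmetrize : Array₄ n →ₗ[ℝ] Array₄ n where
  toFun u a b c d := (u a b c d + u b a c d + u a b d c + u b a d c) / 4
  map_add' u v := by ext a b c d; simp only [Pi.add_apply]; ring
  map_smul' t u := by ext a b c d; simp only [Pi.smul_apply, smul_eq_mul, RingHom.id_apply]; ring

theorem symmetrize_apply (u : Array₄ n) (a b c d : Fin n) :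
    symmetrize u a b c d = (u a b c d + u b a c d + u a b d c + u b a d c) / 4 := rfl

theorem symmetrize_eq_self {u : Array₄ n} (h1 : ∀ a b c d, u a b c d = u b a c d)
    (h2 : ∀ a b c d, u a b c d = u a b d c) : symmetrize u = u := by
  ext a b c d
  rw [symmetrize_apply, ← h2 b a c d, ← h1 a b c d, ← h2 a b c d]
  ring

theorem symmetrize_symmetrize (u : Array₄ n) : symmetrize (symmetrize u) = symmetrize u := by
  refine symmetrize_eq_self (fun a b c d => ?_) (fun a b c d => ?_) <;>
  · simp only [symmetrize_apply]
    ring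

/-- The array `y_a y_b z_c z_d`. -/
def squareArray (y z : Fin n → ℝ) : Array₄ n := fun a b c d => y a * y b * z c * z d

/-- The array `(μ_a ℓ_b + ℓ_a μ_b) ℓ_c ℓ_d`: up to a constant factor, the variation of the second
derivatives of a metric under the diffeomorphism `y ↦ y + ℓ(y)³ v`, where `v` is the vector
corresponding to `μ`. -/
def gaugeArray (μ ℓ : Fin n → ℝ) : Array₄ n :=
  fun a b c d => (μ a * ℓ b + ℓ a * μ b) * ℓ c * ℓ d

/-- Modulo the arrays `gaugeArray`, the array `squareArray y z` is symmetric in `y` and `z`. This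
is dual to the symmetry of `N²` under the exchange of its two pairs of indices; the polarizations
extract the terms of degree two in `z`, respectively in `y`. -/
theorem squareArray_sub_squareArray (y z : Fin n → ℝ) :
    squareArray y z - squareArray z y = (1 / 2 : ℝ) •
      (((1 / 2 : ℝ) • (gaugeArray y (y + z) + gaugeArray y (y - z)) - gaugeArray y y) -
      ((1 / 2 : ℝ) • (gaugeArray z (z + y) + gaugeArray z (z - y)) - gaugeArray z z)) := by
  ext a b c d
  simp only [squareArray, gaugeArray, Pi.sub_apply, Pi.add_apply, Pi.smul_apply, smul_eq_mul]
  ring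

/-- The arrays `squareArray y z` span the symmetrized arrays. -/
theorem span_squareArray_union_ker :
    Submodule.span ℝ ({u | ∃ y z : Fin n → ℝ, u = squareArray y z} ∪
      {u : Array₄ n | symmetrize u = 0}) = ⊤ := by
  rw [eq_top_iff]
  set L := Submodule.span ℝ ({u | ∃ y z : Fin n → ℝ, u = squareArray y z} ∪
      {u : Array₄ n | symmetrize u = 0})
  have hsq : ∀ y z : Fin n → ℝ, squareArray y z ∈ L := fun y z =>
    Submodule.subset_span (.inl ⟨y, z, rfl⟩)
  have hker : ∀ u : Array₄ n, u - symmetrize u ∈ L := fun u =>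
    Submodule.subset_span (.inr (by simp [symmetrize_symmetrize]))
  have hsq' : ∀ x y z : Fin n → ℝ,
      squareArray (x + y) z - squareArray x z - squareArray y z ∈ L := fun x y z =>
    L.sub_mem (L.sub_mem (hsq _ _) (hsq _ _)) (hsq _ _)
  have hprod : ∀ x y z t : Fin n → ℝ, (fun a b c d => x a * y b * z c * t d : Array₄ n) ∈ L := by
    intro x y z t
    have hs : symmetrize (fun a b c d => x a * y b * z c * t d : Array₄ n) ∈ L := by
      have := L.smul_mem (1 / 4 : ℝ) (L.sub_mem (L.sub_mem (hsq' x y (z + t)) (hsq' x y z))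
        (hsq' x y t))
      convert this using 1
      ext a b c d
      simp only [symmetrize_apply, squareArray, Pi.add_apply, Pi.sub_apply, Pi.smul_apply,
        smul_eq_mul]
      ring
    simpa using L.add_mem (hker (fun a b c d => x a * y b * z c * t d)) hs
  intro u _
  have hu : u = ∑ a, ∑ b, ∑ c, ∑ d, u a b c d •
      (fun a' b' c' d' => (Pi.single a (1 : ℝ) : Fin n → ℝ) a' *
        (Pi.single b (1 : ℝ) : Fin n → ℝ) b' * (Pi.single c (1 : ℝ) : Fin n → ℝ) c' *
        (Pi.single d (1 : ℝ) : Fin n → ℝ) d' : Array₄ n) := by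
    ext a b c d
    simp [Finset.sum_apply, Pi.single_apply]
  rw [hu]
  exact L.sum_mem fun a _ => L.sum_mem fun b _ => L.sum_mem fun c _ => L.sum_mem fun d _ =>
    L.smul_mem _ (hprod _ _ _ _)


/-- The coordinate `u_{abcd}`, where `i = (a, b, c, d)`. -/
def entry (i : Fin n × Fin n × Fin n × Fin n) : Array₄ n →L[ℝ] ℝ :=
  LinearMap.toContinuousLinearMap
    { toFun := fun u => u i.1 i.2.1 i.2.2.1 i.2.2.2
      map_add' := fun _ _ => rfl
      map_smul' := fun _ _ => rfl }

theorem entry_apply (i : Fin n × Fin n × Fin n × Fin n) (u : Array₄ n) :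
    entry i u = u i.1 i.2.1 i.2.2.1 i.2.2.2 := rfl

theorem sum_entry_smul (u : Array₄ n) : ∑ i, entry i u • (fun a b c d =>
    if i = (a, b, c, d) then 1 else 0 : Array₄ n) = u := by
  ext a b c d
  simp [Finset.sum_apply, entry_apply]

/-- Functions `f k` of the second derivatives of a metric whose derivatives satisfy the symmetries
of `Div` (`hgauge` is the cyclic symmetry of `N²`, `hdiv` the cyclic symmetry involving the free
index `k`) are polynomials of degree at most `m`, if `2 (m + 1) ≥ n`. The vanishing of the
derivatives of order `m + 1` is proved as the vanishing of `Div`, on the arrays `squareArray`. -/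
theorem exists_mvPolynomial_of_symmetries {m : ℕ} (hm : n ≤ 2 * (m + 1))
    (f : Fin n → Array₄ n → ℝ) (hf : ∀ k, ContDiff ℝ ∞ (f k))
    (hsymm : ∀ k u, f k (symmetrize u) = f k u)
    (hgauge : ∀ k u μ ℓ, f k (u + gaugeArray μ ℓ) = f k u)
    (hdiv : ∀ u y z, ∑ k, z k * fderiv ℝ (f k) u (squareArray y z) = 0) (k : Fin n) :
    ∃ P : MvPolynomial (Fin n × Fin n × Fin n × Fin n) ℝ, P.totalDegree ≤ m ∧
      ∀ u, f k u = MvPolynomial.eval (fun i => u i.1 i.2.1 i.2.2.1 i.2.2.2) P := by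
  have hconst : ∀ k u w, (∀ t : ℝ, f k (u + t • w) = f k u) → fderiv ℝ (f k) u w = 0 := by
    intro k u w h
    have h1 := (((hf k).differentiable (by simp)) u).hasFDerivAt.hasLineDerivAt w
    have h2 : HasLineDerivAt ℝ (f k) 0 u w := by
      simp only [HasLineDerivAt, h]
      exact hasDerivAt_const _ _
    exact h1.unique h2
  have hker : ∀ k u w, symmetrize w = 0 → fderiv ℝ (f k) u w = 0 := by
    intro k u w hw
    refine hconst k u w fun t => ?_
    rw [← hsymm, map_add, map_smul, hw, smul_zero, add_zero, hsymm]
  have hgauge' : ∀ k u μ ℓ, fderiv ℝ (f k) u (gaugeArray μ ℓ) = 0 := by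
    intro k u μ ℓ
    refine hconst k u _ fun t => ?_
    rw [← hgauge k u (t • μ) ℓ]
    congr 2
    ext a b c d
    simp only [gaugeArray, Pi.smul_apply, smul_eq_mul]
    ring
  have hswap : ∀ k u y z, fderiv ℝ (f k) u (squareArray y z) =
      fderiv ℝ (f k) u (squareArray z y) := by
    intro k u y z
    rw [← sub_eq_zero, ← map_sub, squareArray_sub_squareArray]
    simp [hgauge']
  have hdiv' : ∀ u y z, ∑ k, y k * fderiv ℝ (f k) u (squareArray y z) = 0 := by
    intro u y z
    simp only [fun k => hswap k u y z]
    exact hdiv u z y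
  have hcontract : ∀ (x : Fin n → ℝ) (w₀ : Array₄ n),
      (∀ u, ∑ k, x k * fderiv ℝ (f k) u w₀ = 0) →
      ∀ u (w : Fin (m + 1) → Array₄ n) i, w i = w₀ →
        ∑ k, x k * iteratedFDeriv ℝ (m + 1) (f k) u w = 0 :=
    fun x w₀ h u w i hi => sum_mul_iteratedFDeriv_apply_eq_zero (m + 1) hf x h u w i hi
  have hsquare : ∀ u (w : Fin (m + 1) ⊕ Fin (m + 1) → Fin n → ℝ) k,
      iteratedFDeriv ℝ (m + 1) (f k) u (fun i => squareArray (w (.inl i)) (w (.inr i))) = 0 := by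
    intro u w k
    let Θ : (Fin (m + 1) ⊕ Fin (m + 1) → Fin n → ℝ) → Module.Dual ℝ (Fin n → ℝ) := fun w =>
      ∑ k, iteratedFDeriv ℝ (m + 1) (f k) u (fun i => squareArray (w (.inl i)) (w (.inr i))) •
        LinearMap.proj k
    have hΘ : ∀ w x, Θ w x = ∑ k, x k * iteratedFDeriv ℝ (m + 1) (f k) u
        (fun i => squareArray (w (.inl i)) (w (.inr i))) := by
      intro w x
      simp [Θ, mul_comm]
    have := eq_zero_of_annihilates_family (by simp; omega) Θ ?_ ?_ w
    · have h := hΘ w (Pi.single k 1)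
      rw [this] at h
      simpa [Pi.single_apply] using h.symm
    · rintro w (i | i) <;> rw [hΘ]
      · exact hcontract _ _ (fun u => hdiv' u _ _) u _ i rfl
      · exact hcontract _ _ (fun u => hdiv u _ _) u _ i rfl
    · intro w w' x
      simp only [hΘ]
      refine continuous_finsetSum _ fun k _ => continuous_const.mul
        ((iteratedFDeriv ℝ (m + 1) (f k) u).cont.comp (continuous_pi fun i => ?_))
      refine continuous_pi fun a => continuous_pi fun b => continuous_pi fun c =>
        continuous_pi fun d => ?_
      simp only [squareArray, Pi.add_apply, Pi.smul_apply, smul_eq_mul]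
      fun_prop
  have hzero : ∀ u w, iteratedFDeriv ℝ (m + 1) (f k) u w = 0 := by
    intro u w
    have := multilinear_eq_zero_of_span
      (iteratedFDeriv ℝ (m + 1) (f k) u).toMultilinearMap span_squareArray_union_ker
      (fun w hw => ?_)
    · exact congrArg (fun M => M w) this
    · by_cases h : ∃ i, symmetrize (w i) = 0
      · obtain ⟨i, hi⟩ := h
        exact iteratedFDeriv_apply_eq_zero (m + 1) (hf k) (fun u => hker k u _ hi) u w i rfl
      · have hw' : ∀ i, ∃ y z, w i = squareArray y z := fun i =>
          (hw i).resolve_right fun hi => h ⟨i, hi⟩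
        choose y z hyz using hw'
        obtain rfl : w = fun i => squareArray (y i) (z i) := funext hyz
        exact hsquare u (Sum.elim y z) k
  exact exists_mvPolynomial_of_iteratedFDeriv_eq_zero entry _ sum_entry_smul m (hf k) hzero

end Fibre

/-! ### Signature of a metric -/

section Signature

variable {V W : Type*} [AddCommGroup V] [Module ℝ V] [AddCommGroup W] [Module ℝ W] {r s : ℕ}

theorem IsMetric.compl₁₂ {b : LinearMap.BilinForm ℝ W} (hb : IsMetric r s b) (e : V ≃ₗ[ℝ] W) :
    IsMetric r s (LinearMap.compl₁₂ b e.toLinearMap e.toLinearMap) := by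
  have heq : QuadraticMap.Equivalent
      (LinearMap.BilinMap.toQuadraticMap (LinearMap.compl₁₂ b e.toLinearMap e.toLinearMap))
      (LinearMap.BilinMap.toQuadraticMap b) := ⟨⟨e, fun v => by simp⟩⟩
  refine ⟨⟨fun x y => ?_⟩, ?_, ?_, ?_⟩
  · simpa using hb.symm.eq (e x) (e y)
  · have := hb.nondegenerate.congr e.symm
    convert this using 1
    exact LinearMap.ext₂ fun _ _ => rfl
  · rw [heq.sigPos_eq, hb.sigPos_eq]
  · rw [heq.sigNeg_eq, hb.sigNeg_eq]

/-- The index of positivity is lower semicontinuous. -/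
theorem eventually_sigPos_le {Y E : Type*} [TopologicalSpace Y] [NormedAddCommGroup E]
    [NormedSpace ℝ E] [FiniteDimensional ℝ E] (Q : Y → QuadraticForm ℝ E) (y₀ : Y)
    (hQ : ∀ v, ContinuousAt (fun z : Y × E => Q z.1 z.2) (y₀, v)) :
    ∀ᶠ y in 𝓝 y₀, sigPos (Q y₀) ≤ sigPos (Q y) := by
  obtain ⟨L, hL, hpos⟩ := exists_finrank_eq_sigPos_and_posDef (Q y₀)
  -- `Q y₀` is positive on the unit sphere of `L`, which is compact, so `Q y` is as well for `y`
  -- near `y₀`.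
  have hK : IsCompact ((L : Set E) ∩ Metric.sphere 0 1) :=
    (isCompact_sphere 0 1).inter_left L.closed_of_finiteDimensional
  have := hK.eventually_forall_of_forall_eventually (x₀ := y₀)
    (P := fun y v => 0 < Q y v) (fun v hv => by
      refine (hQ v).eventually (lt_mem_nhds ?_)
      refine hpos ⟨v, hv.1⟩ fun h => ?_
      have h0 : v = 0 := congrArg Subtype.val h
      have := hv.2
      simp [h0] at this)
  filter_upwards [this] with y hy
  rw [← hL]
  refine le_sigPos_of_posDef _ fun v hv => ?_
  have hv' : ‖(v : E)‖ ≠ 0 := by simpa using hv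
  have h1 := hy (‖(v : E)‖⁻¹ • (v : E)) ⟨L.smul_mem _ v.2, by
    simp [norm_smul, inv_mul_cancel₀ hv']⟩
  rw [QuadraticMap.map_smul, smul_eq_mul] at h1
  exact pos_of_mul_pos_right h1 (by positivity)

/-- Among symmetric matrices, those of signature `(r, s)` form an open set, if `r + s = n`. -/
theorem eventually_isMetric {n : ℕ} (hrs : r + s = n) {Y : Type*} [TopologicalSpace Y]
    {G : Y → Fin n → Fin n → ℝ} (hG : ∀ a b, Continuous fun y => G y a b)
    (hsymm : ∀ y a b, G y a b = G y b a) {y₀ : Y}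
    (h₀ : IsMetric r s (Matrix.toBilin' (Matrix.of (G y₀)))) :
    ∀ᶠ y in 𝓝 y₀, IsMetric r s (Matrix.toBilin' (Matrix.of (G y))) := by
  let Q : Y → QuadraticForm ℝ (Fin n → ℝ) := fun y =>
    LinearMap.BilinMap.toQuadraticMap (Matrix.toBilin' (Matrix.of (G y)))
  have hQc : Continuous fun z : Y × (Fin n → ℝ) => Q z.1 z.2 := by
    simp only [Q, LinearMap.BilinMap.toQuadraticMap_apply, Matrix.toBilin'_apply, Matrix.of_apply]
    refine continuous_finsetSum _ fun a _ => continuous_finsetSum _ fun b _ => ?_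
    have := (hG a b).comp (continuous_fst (X := Y) (Y := Fin n → ℝ))
    simp only [Function.comp_def] at this
    fun_prop
  have hdet : ∀ᶠ y in 𝓝 y₀, (Matrix.of (G y)).det ≠ 0 := by
    have hc : Continuous fun y => (Matrix.of (G y)).det :=
      Continuous.matrix_det (continuous_matrix hG)
    exact hc.continuousAt.eventually_ne
      (LinearMap.BilinForm.nondegenerate_toBilin'_iff_det_ne_zero.mp h₀.nondegenerate)
  have hpos := eventually_sigPos_le Q y₀ fun v => hQc.continuousAt
  have hneg := eventually_sigPos_le (fun y => -Q y) y₀ fun v => by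
    exact hQc.continuousAt.neg
  filter_upwards [hdet, hpos, hneg] with y hy1 hy2 hy3
  -- Both indices can only increase, and their sum is at most `n = r + s`.
  have h1 : r ≤ sigPos (Q y) := h₀.sigPos_eq ▸ hy2
  have h2 : s ≤ sigNeg (Q y) := h₀.sigNeg_eq ▸ hy3
  have h3 := QuadraticForm.sigPos_add_sigNeg_add_radical (Q := Q y)
  rw [Module.finrank_fin_fun] at h3
  refine ⟨⟨fun v w => ?_⟩, LinearMap.BilinForm.nondegenerate_toBilin'_iff_det_ne_zero.mpr hy1,
    by change sigPos (Q y) = r; omega, by change sigNeg (Q y) = s; omega⟩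
  rw [Matrix.toBilin'_apply, Matrix.toBilin'_apply, Finset.sum_comm]
  refine Finset.sum_congr rfl fun a _ => Finset.sum_congr rfl fun b _ => ?_
  rw [Matrix.of_apply, Matrix.of_apply, hsymm]
  ring

theorem IsMetric.symm_apply {n : ℕ} {G : Fin n → Fin n → ℝ}
    (h : IsMetric r s (Matrix.toBilin' (Matrix.of G))) (a b : Fin n) : G a b = G b a := by
  have := h.symm.eq (Pi.single a 1) (Pi.single b 1)
  simpa [Matrix.toBilin'_single] using this

end Signature

/-! ### Charts -/

section Charts

variable {n : ℕ} {X : Type*} [TopologicalSpace X] [ChartedSpace (Model n) X]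
  {φ ψ : OpenPartialHomeomorph X (Model n)}

theorem IsChart.mdifferentiable (hφ : IsChart φ) :
    φ.MDifferentiable 𝓘(ℝ, Model n) 𝓘(ℝ, Model n) :=
  ⟨(contMDiffOn_of_mem_maximalAtlas hφ).mdifferentiableOn (by simp),
    (contMDiffOn_symm_of_mem_maximalAtlas hφ).mdifferentiableOn (by simp)⟩

theorem IsChart.contDiffOn_transition (hφ : IsChart φ) (hψ : IsChart ψ) :
    ContDiffOn ℝ ∞ (φ ∘ ψ.symm) (ψ.target ∩ ψ.symm ⁻¹' φ.source) := by
  rw [← contMDiffOn_iff_contDiffOn]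
  exact (contMDiffOn_of_mem_maximalAtlas hφ).comp
    ((contMDiffOn_symm_of_mem_maximalAtlas hψ).mono Set.inter_subset_left) fun y hy => hy.2

/-- The chain rule: the covectors `dx^j` of `φ` and the vectors `∂_a` of `ψ` are paired by the
Jacobian matrix of the transition map. -/
theorem coordCovector_coordVector (hφ : IsChart φ) (hψ : IsChart ψ) {y : Model n}
    (hy : y ∈ ψ.target) (hy' : ψ.symm y ∈ φ.source) (a j : Fin n) :
    coordCovector φ (ψ.symm y) j (coordVector ψ y a) =
      partialDeriv a (fun y => φ (ψ.symm y) j) y := by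
  have h1 : MDifferentiableAt 𝓘(ℝ, Model n) 𝓘(ℝ, Model n) φ (ψ.symm y) :=
    hφ.mdifferentiable.mdifferentiableAt hy'
  have h2 : MDifferentiableAt 𝓘(ℝ, Model n) 𝓘(ℝ, Model n) ψ.symm y :=
    hψ.mdifferentiable.symm.mdifferentiableAt hy
  have h3 := mfderiv_comp y h1 h2
  rw [mfderiv_eq_fderiv] at h3
  have h4 : DifferentiableAt ℝ (φ ∘ ψ.symm) y :=
    (h1.comp y h2).differentiableAt
  have h5 : fderiv ℝ (fun y => φ (ψ.symm y) j) y =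
      (EuclideanSpace.proj (𝕜 := ℝ) j).comp (fderiv ℝ (φ ∘ ψ.symm) y) :=
    ((EuclideanSpace.proj (𝕜 := ℝ) j).hasFDerivAt.comp y h4.hasFDerivAt).fderiv
  rw [partialDeriv, h5, h3]
  rfl

theorem partialDeriv_congr {k : Fin n} {f g : Model n → ℝ} {y : Model n} (h : f =ᶠ[𝓝 y] g) :
    partialDeriv k f y = partialDeriv k g y := by
  rw [partialDeriv, h.fderiv_eq, partialDeriv]

theorem coordCovector_coordVector_self (hφ : IsChart φ) {y : Model n} (hy : y ∈ φ.target)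
    (a j : Fin n) :
    coordCovector φ (φ.symm y) j (coordVector φ y a) = if a = j then 1 else 0 := by
  rw [coordCovector_coordVector hφ hφ hy (φ.map_target hy)]
  have h : (fun y => φ (φ.symm y) j) =ᶠ[𝓝 y] EuclideanSpace.proj (𝕜 := ℝ) j := by
    filter_upwards [φ.open_target.mem_nhds hy] with z hz
    simp [φ.right_inv hz]
  rw [partialDeriv_congr h, partialDeriv, ContinuousLinearMap.fderiv]
  simp [eq_comm]

/-- The components of tangent vectors in the chart `φ`, as a linear isomorphism. -/
def tangentCoord (hφ : IsChart φ) {x : X} (hx : x ∈ φ.source) :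
    TangentSpace 𝓘(ℝ, Model n) x ≃ₗ[ℝ] (Fin n → ℝ) :=
  (hφ.mdifferentiable.mfderiv hx).toLinearEquiv ≪≫ₗ
    (NormedSpace.fromTangentSpace (𝕜 := ℝ) (φ x)).toLinearEquiv ≪≫ₗ
    (EuclideanSpace.equiv (Fin n) ℝ).toLinearEquiv

theorem tangentCoord_apply (hφ : IsChart φ) {x : X} (hx : x ∈ φ.source)
    (v : TangentSpace 𝓘(ℝ, Model n) x) (j : Fin n) :
    tangentCoord hφ hx v j = coordCovector φ x j v := rfl

theorem tangentCoord_coordVector (hφ : IsChart φ) {y : Model n} (hy : y ∈ φ.target) (a : Fin n) :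
    tangentCoord hφ (φ.map_target hy) (coordVector φ y a) = Pi.single a 1 := by
  ext j
  rw [tangentCoord_apply, coordCovector_coordVector_self hφ hy]
  simp [Pi.single_apply, eq_comm]

/-- The matrix of components of a metric in a chart is a metric of the same signature. -/
theorem isMetric_fieldComponents {r s : ℕ} (hφ : IsChart φ)
    {g : ∀ x : X, LinearMap.BilinForm ℝ (TangentSpace 𝓘(ℝ, Model n) x)} {y : Model n}
    (hy : y ∈ φ.target) (hg : IsMetric r s (g (φ.symm y))) :
    IsMetric r s (Matrix.toBilin' (Matrix.of fun a b => fieldComponents φ g a b y)) := by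
  convert hg.compl₁₂ (tangentCoord hφ (φ.map_target hy)).symm using 1
  refine LinearMap.BilinForm.toMatrix'.injective ?_
  ext a b
  have h := fun a => (LinearEquiv.symm_apply_eq _).mpr (tangentCoord_coordVector hφ hy a).symm
  simp [LinearMap.BilinForm.toMatrix'_apply, h, fieldComponents]

theorem contDiffOn_partialDeriv {f : Model n → ℝ} {U : Set (Model n)} (hU : IsOpen U)
    (hf : ContDiffOn ℝ ∞ f U) (k : Fin n) : ContDiffOn ℝ ∞ (partialDeriv k f) U :=
  (hf.fderiv_of_isOpen (m := ∞) hU le_rfl).clm_apply contDiffOn_const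

/-! ### Local metrics with given components -/

variable {r s : ℕ} {U : Set (Model n)} {G : Model n → Fin n → Fin n → ℝ}

/-- The local metric on `φ.source ∩ φ ⁻¹' U` with components `G` in the chart `φ`. -/
def LocalMetric.ofComponents (hφ : IsChart φ) (hU : IsOpen U)
    (hG : ∀ a b, ContDiffOn ℝ ∞ (fun y => G y a b) U)
    (hM : ∀ y ∈ U, IsMetric r s (Matrix.toBilin' (Matrix.of (G y)))) :
    LocalMetric (n := n) X r s where
  domain := φ.source ∩ φ ⁻¹' U
  isOpen_domain := φ.isOpen_inter_preimage hU
  form x := LinearMap.compl₁₂ (Matrix.toBilin' (Matrix.of (G (φ x))))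
    (LinearMap.pi fun j => coordCovector φ x j) (LinearMap.pi fun j => coordCovector φ x j)
  isMetric x hx := (hM _ hx.2).compl₁₂ (tangentCoord hφ hx.1)
  smooth ψ hψ a b := by
    have hset : IsOpen (ψ.target ∩ ψ.symm ⁻¹' (φ.source ∩ φ ⁻¹' U)) :=
      ψ.symm.isOpen_inter_preimage (φ.isOpen_inter_preimage hU)
    have htr : ContDiffOn ℝ ∞ (φ ∘ ψ.symm) (ψ.target ∩ ψ.symm ⁻¹' (φ.source ∩ φ ⁻¹' U)) :=
      (hφ.contDiffOn_transition hψ).mono fun y hy => ⟨hy.1, hy.2.1⟩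
    have htr' : ∀ c, ContDiffOn ℝ ∞ (fun y => φ (ψ.symm y) c)
        (ψ.target ∩ ψ.symm ⁻¹' (φ.source ∩ φ ⁻¹' U)) := fun c =>
      (EuclideanSpace.proj (𝕜 := ℝ) c).contDiff.comp_contDiffOn htr
    have : ContDiffOn ℝ ∞ (fun y => ∑ c, ∑ d,
        partialDeriv a (fun y => φ (ψ.symm y) c) y * G ((φ ∘ ψ.symm) y) c d *
          partialDeriv b (fun y => φ (ψ.symm y) d) y)
        (ψ.target ∩ ψ.symm ⁻¹' (φ.source ∩ φ ⁻¹' U)) :=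
      ContDiffOn.sum fun c _ => ContDiffOn.sum fun d _ =>
        (((contDiffOn_partialDeriv hset (htr' c) a).mul
          ((hG c d).comp htr fun y hy => hy.2.2)).mul (contDiffOn_partialDeriv hset (htr' d) b))
    refine this.congr fun y hy => ?_
    simp only [fieldComponents, LinearMap.compl₁₂_apply, Matrix.toBilin'_apply, LinearMap.pi_apply,
      coordCovector_coordVector hφ hψ hy.1 hy.2.1, Matrix.of_apply, Function.comp]

section OfComponents

variable (hφ : IsChart φ) (hU : IsOpen U) (hG : ∀ a b, ContDiffOn ℝ ∞ (fun y => G y a b) U)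
  (hM : ∀ y ∈ U, IsMetric r s (Matrix.toBilin' (Matrix.of (G y))))

theorem LocalMetric.comp_ofComponents {y : Model n} (hy : y ∈ φ.target) (a b : Fin n) :
    (LocalMetric.ofComponents hφ hU hG hM).comp φ a b y = G y a b := by
  simp [LocalMetric.comp, LocalMetric.ofComponents, fieldComponents, Matrix.toBilin'_apply,
    coordCovector_coordVector_self hφ hy, φ.right_inv hy]

theorem LocalMetric.coord₀_ofComponents {y : Model n} (hy : y ∈ φ.target) :
    (LocalMetric.ofComponents hφ hU hG hM).coord₀ φ y = G y := by
  ext a b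
  exact LocalMetric.comp_ofComponents hφ hU hG hM hy a b

theorem LocalMetric.coord₁_ofComponents {y : Model n} (hy : y ∈ φ.target) :
    (LocalMetric.ofComponents hφ hU hG hM).coord₁ φ y =
      fun a b c => partialDeriv c (fun y => G y a b) y := by
  ext a b c
  refine partialDeriv_congr ?_
  filter_upwards [φ.open_target.mem_nhds hy] with z hz
  exact LocalMetric.comp_ofComponents hφ hU hG hM hz a b

theorem LocalMetric.coord₂_ofComponents {y : Model n} (hy : y ∈ φ.target) :
    (LocalMetric.ofComponents hφ hU hG hM).coord₂ φ y =
      fun a b c d => partialDeriv d (partialDeriv c fun y => G y a b) y := by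
  ext a b c d
  refine partialDeriv_congr ?_
  filter_upwards [φ.open_target.mem_nhds hy] with z hz
  exact congrFun (congrFun (congrFun
    (LocalMetric.coord₁_ofComponents hφ hU hG hM hz) a) b) c

end OfComponents

/-! ### Symmetries of the coordinates of a 2-jet -/

theorem partialDeriv_comm {f : Model n → ℝ} {y : Model n} (hf : ContDiffAt ℝ ∞ f y)
    (c d : Fin n) :
    partialDeriv d (partialDeriv c f) y = partialDeriv c (partialDeriv d f) y := by
  have hd : DifferentiableAt ℝ (fderiv ℝ f) y :=
    (hf.fderiv_right (m := ∞) le_rfl).differentiableAt (by simp)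
  have key : ∀ c d, partialDeriv d (partialDeriv c f) y =
      fderiv ℝ (fderiv ℝ f) y (EuclideanSpace.single d 1) (EuclideanSpace.single c 1) := by
    intro c d
    change fderiv ℝ (fun z => fderiv ℝ f z (EuclideanSpace.single c 1)) y _ = _
    rw [fderiv_clm_apply hd (differentiableAt_const _)]
    simp
  rw [key, key]
  exact hf.isSymmSndFDerivAt
    (by rw [minSmoothness_of_isRCLikeNormedField]; exact WithTop.coe_le_coe.2 le_top) _ _

/-- The coordinates of the 2-jet at the point of coordinates `y`. -/
def LocalMetric.jetCoord (g : LocalMetric (n := n) X r s) (φ : OpenPartialHomeomorph X (Model n))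
    (y : Model n) : JetCoord n :=
  (y, g.coord₀ φ y, g.coord₁ φ y, g.coord₂ φ y)

/-- The coordinates of a 2-jet have the required symmetries, by symmetry of the metric and of its
second derivatives. -/
theorem LocalMetric.jetCoord_mem (hφ : IsChart φ) (g : LocalMetric (n := n) X r s) {y : Model n}
    (hy : y ∈ φ.target) (hg : φ.symm y ∈ g.domain) : g.jetCoord φ y ∈ jetCoordSet r s φ := by
  have hopen : IsOpen (φ.target ∩ φ.symm ⁻¹' g.domain) :=
    φ.symm.isOpen_inter_preimage g.isOpen_domain
  have hev : ∀ᶠ z in 𝓝 y, z ∈ φ.target ∩ φ.symm ⁻¹' g.domain := hopen.mem_nhds ⟨hy, hg⟩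
  have hM : ∀ z ∈ φ.target ∩ φ.symm ⁻¹' g.domain,
      IsMetric r s (Matrix.toBilin' (Matrix.of (g.coord₀ φ z))) := fun z hz =>
    isMetric_fieldComponents hφ hz.1 (g.isMetric _ hz.2)
  have hsymm₁ : ∀ z ∈ φ.target ∩ φ.symm ⁻¹' g.domain, ∀ a b c,
      g.coord₁ φ z a b c = g.coord₁ φ z b a c := by
    intro z hz a b c
    refine partialDeriv_congr ?_
    filter_upwards [hopen.mem_nhds hz] with z' hz'
    exact (hM z' hz').symm_apply a b
  refine ⟨hy, hM y ⟨hy, hg⟩, hsymm₁ y ⟨hy, hg⟩, fun a b c d => ?_, fun a b c d => ?_⟩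
  · refine partialDeriv_congr ?_
    filter_upwards [hev] with z hz
    exact hsymm₁ z hz a b c
  · exact partialDeriv_comm ((g.smooth φ hφ a b).contDiffAt (hopen.mem_nhds ⟨hy, hg⟩)) c d

end Charts

/-! ### Partial derivatives -/

section PartialDeriv

variable {n : ℕ} {f g : Model n → ℝ}

theorem contDiff_partialDeriv (hf : ContDiff ℝ ∞ f) (k : Fin n) :
    ContDiff ℝ ∞ (partialDeriv k f) :=
  (hf.fderiv_right (m := ∞) le_rfl).clm_apply contDiff_const

theorem partialDeriv_add (hf : ContDiff ℝ ∞ f) (hg : ContDiff ℝ ∞ g) (k : Fin n) :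
    partialDeriv k (fun y => f y + g y) = fun y => partialDeriv k f y + partialDeriv k g y := by
  ext y
  simp only [partialDeriv]
  rw [fderiv_fun_add (hf.differentiable (by simp) y) (hg.differentiable (by simp) y)]
  simp

theorem partialDeriv_mul (hf : ContDiff ℝ ∞ f) (hg : ContDiff ℝ ∞ g) (k : Fin n) :
    partialDeriv k (fun y => f y * g y) =
      fun y => partialDeriv k f y * g y + f y * partialDeriv k g y := by
  ext y
  simp only [partialDeriv]
  rw [fderiv_fun_mul (hf.differentiable (by simp) y) (hg.differentiable (by simp) y)]
  simp only [add_apply, smul_apply, smul_eq_mul]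
  ring

theorem partialDeriv_sum {ι : Type*} [Fintype ι] {f : ι → Model n → ℝ}
    (hf : ∀ i, ContDiff ℝ ∞ (f i)) (k : Fin n) :
    partialDeriv k (fun y => ∑ i, f i y) = fun y => ∑ i, partialDeriv k (f i) y := by
  ext y
  simp only [partialDeriv]
  rw [fderiv_fun_sum fun i _ => (hf i).differentiable (by simp) y]
  simp

theorem partialDeriv_const (k : Fin n) (t : ℝ) :
    partialDeriv k (fun _ : Model n => t) = fun _ => 0 := by
  ext y
  simp [partialDeriv]

theorem partialDeriv_clm_sub (ℓ : Model n →L[ℝ] ℝ) (y₀ : Model n) (k : Fin n) :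
    partialDeriv k (fun y => ℓ (y - y₀)) = fun _ => ℓ (EuclideanSpace.single k 1) := by
  ext y
  have : HasFDerivAt (fun y => ℓ (y - y₀)) ℓ y :=
    ℓ.hasFDerivAt.comp y ((hasFDerivAt_id y).sub_const y₀)
  rw [partialDeriv, this.fderiv]

theorem contDiff_clm_sub (ℓ : Model n →L[ℝ] ℝ) (y₀ : Model n) :
    ContDiff ℝ ∞ fun y => ℓ (y - y₀) :=
  ℓ.contDiff.comp (contDiff_id.sub contDiff_const)

theorem partialDeriv_clm_sub_sq (ℓ : Model n →L[ℝ] ℝ) (y₀ : Model n) (k : Fin n) :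
    partialDeriv k (fun y => ℓ (y - y₀) ^ 2) =
      fun y => 2 * ℓ (EuclideanSpace.single k 1) * ℓ (y - y₀) := by
  simp only [sq]
  rw [partialDeriv_mul (contDiff_clm_sub ℓ y₀) (contDiff_clm_sub ℓ y₀), partialDeriv_clm_sub]
  ext y
  ring

theorem partialDeriv_clm_sub_cube (ℓ : Model n →L[ℝ] ℝ) (y₀ : Model n) (k : Fin n) :
    partialDeriv k (fun y => ℓ (y - y₀) ^ 3) =
      fun y => 3 * ℓ (EuclideanSpace.single k 1) * ℓ (y - y₀) ^ 2 := by
  have : (fun y => ℓ (y - y₀) ^ 3) = fun y => ℓ (y - y₀) ^ 2 * ℓ (y - y₀) := by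
    ext y
    ring
  rw [this, partialDeriv_mul ((contDiff_clm_sub ℓ y₀).pow 2) (contDiff_clm_sub ℓ y₀),
    partialDeriv_clm_sub, partialDeriv_clm_sub_sq]
  ext y
  ring

/-- The polynomial of degree two with value `t₀`, first derivatives `t₁` and second derivatives
`t₂` (if these are symmetric) at `y₀`. -/
def quadraticPoly (y₀ : Model n) (t₀ : ℝ) (t₁ : Fin n → ℝ) (t₂ : Fin n → Fin n → ℝ)
    (y : Model n) : ℝ :=
  t₀ + ∑ c, t₁ c * (y - y₀) c + ∑ c, ∑ d, t₂ c d / 2 * ((y - y₀) c * (y - y₀) d)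

theorem contDiff_coord_sub (y₀ : Model n) (c : Fin n) : ContDiff ℝ ∞ fun y => (y - y₀) c :=
  contDiff_clm_sub (EuclideanSpace.proj (𝕜 := ℝ) c) y₀

theorem partialDeriv_coord_sub (y₀ : Model n) (c k : Fin n) :
    partialDeriv k (fun y => (y - y₀) c) = fun _ => if c = k then 1 else 0 := by
  have := partialDeriv_clm_sub (EuclideanSpace.proj (𝕜 := ℝ) c) y₀ k
  refine this.trans ?_
  ext y
  simp

theorem contDiff_quadraticPoly (y₀ : Model n) (t₀ : ℝ) (t₁ : Fin n → ℝ)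
    (t₂ : Fin n → Fin n → ℝ) : ContDiff ℝ ∞ (quadraticPoly y₀ t₀ t₁ t₂) := by
  have := contDiff_coord_sub y₀
  unfold quadraticPoly
  fun_prop

theorem partialDeriv_const_mul (hf : ContDiff ℝ ∞ f) (t : ℝ) (k : Fin n) :
    partialDeriv k (fun y => t * f y) = fun y => t * partialDeriv k f y := by
  rw [partialDeriv_mul contDiff_const hf, partialDeriv_const]
  simp

theorem partialDeriv_affine (y₀ : Model n) (t₀ : ℝ) (t₁ : Fin n → ℝ) (k : Fin n) :
    partialDeriv k (fun y => t₀ + ∑ c, t₁ c * (y - y₀) c) = fun _ => t₁ k := by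
  have h := contDiff_coord_sub y₀
  rw [partialDeriv_add contDiff_const (by fun_prop), partialDeriv_const,
    partialDeriv_sum (f := fun c (y : Model n) => t₁ c * (y - y₀) c) fun c => by fun_prop]
  simp only [partialDeriv_const_mul (h _), partialDeriv_coord_sub]
  simp

theorem partialDeriv_quadraticPoly (y₀ : Model n) (t₀ : ℝ) (t₁ : Fin n → ℝ)
    {t₂ : Fin n → Fin n → ℝ} (ht₂ : ∀ c d, t₂ c d = t₂ d c) (k : Fin n) :
    partialDeriv k (quadraticPoly y₀ t₀ t₁ t₂) =
      fun y => t₁ k + ∑ d, t₂ k d * (y - y₀) d := by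
  have h := contDiff_coord_sub y₀
  unfold quadraticPoly
  rw [partialDeriv_add (by fun_prop) (by fun_prop), partialDeriv_affine,
    partialDeriv_sum (f := fun c (y : Model n) => ∑ d, t₂ c d / 2 * ((y - y₀) c * (y - y₀) d))
      fun c => by fun_prop]
  ext y
  congr 1
  have key : ∀ c, partialDeriv k (fun y => ∑ d, t₂ c d / 2 * ((y - y₀) c * (y - y₀) d)) y =
      ∑ d, t₂ c d / 2 * ((if c = k then 1 else 0) * (y - y₀) d +
        (y - y₀) c * if d = k then 1 else 0) := by
    intro c
    rw [partialDeriv_sum (f := fun d (y : Model n) => t₂ c d / 2 * ((y - y₀) c * (y - y₀) d))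
      fun d => by fun_prop]
    refine Finset.sum_congr rfl fun d _ => ?_
    rw [partialDeriv_const_mul (f := fun y : Model n => (y - y₀) c * (y - y₀) d) (by fun_prop),
      partialDeriv_mul (h c) (h d), partialDeriv_coord_sub, partialDeriv_coord_sub]
  simp only [key, mul_add, Finset.sum_add_distrib]
  rw [Finset.sum_comm]
  simp only [ite_mul, mul_ite, one_mul, mul_one, zero_mul, mul_zero, Finset.sum_ite_eq',
    Finset.mem_univ, if_true, ht₂ _ k, ← Finset.sum_add_distrib]
  refine Finset.sum_congr rfl fun d _ => ?_
  ring

theorem partialDeriv_partialDeriv_quadraticPoly (y₀ : Model n) (t₀ : ℝ) (t₁ : Fin n → ℝ)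
    {t₂ : Fin n → Fin n → ℝ} (ht₂ : ∀ c d, t₂ c d = t₂ d c) (c d : Fin n) :
    partialDeriv d (partialDeriv c (quadraticPoly y₀ t₀ t₁ t₂)) = fun _ => t₂ c d := by
  rw [partialDeriv_quadraticPoly y₀ t₀ t₁ ht₂, partialDeriv_affine]

theorem quadraticPoly_self (y₀ : Model n) (t₀ : ℝ) (t₁ : Fin n → ℝ) (t₂ : Fin n → Fin n → ℝ) :
    quadraticPoly y₀ t₀ t₁ t₂ y₀ = t₀ := by
  simp [quadraticPoly]

/-! ### The diffeomorphisms `y ↦ y + ℓ(y - y₀)³ v` -/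

/-- The map `y ↦ y + ℓ(y - y₀)³ v`, whose 2-jet at `y₀` is that of the identity. -/
def cubicShear (y₀ v : Model n) (ℓ : Model n →L[ℝ] ℝ) (y : Model n) : Model n :=
  y + ℓ (y - y₀) ^ 3 • v

variable (y₀ v : Model n) (ℓ : Model n →L[ℝ] ℝ)

theorem cubicShear_self : cubicShear y₀ v ℓ y₀ = y₀ := by
  simp [cubicShear]

theorem contDiff_cubicShear : ContDiff ℝ ∞ (cubicShear y₀ v ℓ) :=
  contDiff_id.add (((contDiff_clm_sub ℓ y₀).pow 3).smul contDiff_const)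

theorem hasFDerivAt_cubicShear (y : Model n) :
    HasFDerivAt (cubicShear y₀ v ℓ)
      (ContinuousLinearMap.id ℝ _ + ((3 * ℓ (y - y₀) ^ 2) • ℓ).smulRight v) y := by
  have h : HasFDerivAt (fun y => ℓ (y - y₀)) ℓ y :=
    ℓ.hasFDerivAt.comp y ((hasFDerivAt_id y).sub_const y₀)
  refine (hasFDerivAt_id y).add ?_
  convert (h.pow 3).smul_const v using 1
  simp

theorem partialDeriv_comp_cubicShear (hf : ContDiff ℝ ∞ f) (k : Fin n) :
    partialDeriv k (fun y => f (cubicShear y₀ v ℓ y)) =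
      fun y => partialDeriv k f (cubicShear y₀ v ℓ y) + ℓ (y - y₀) ^ 2 *
        (3 * ℓ (EuclideanSpace.single k 1) * fderiv ℝ f (cubicShear y₀ v ℓ y) v) := by
  ext y
  have := ((hf.differentiable (by simp)) (cubicShear y₀ v ℓ y)).hasFDerivAt.comp y
    (hasFDerivAt_cubicShear y₀ v ℓ y)
  rw [partialDeriv]
  erw [this.fderiv]
  simp [partialDeriv]
  ring

theorem contDiff_comp_cubicShear (hf : ContDiff ℝ ∞ f) :
    ContDiff ℝ ∞ fun y => f (cubicShear y₀ v ℓ y) :=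
  hf.comp (contDiff_cubicShear y₀ v ℓ)

theorem partialDeriv_sq_mul_self (hf : ContDiff ℝ ∞ f) (k : Fin n) :
    partialDeriv k (fun y => ℓ (y - y₀) ^ 2 * f y) y₀ = 0 := by
  rw [partialDeriv_mul ((contDiff_clm_sub ℓ y₀).pow 2) hf, partialDeriv_clm_sub_sq]
  simp

/-- The first derivatives of a function are not changed at `y₀` by composition with a cubic shear
and addition of a multiple of `ℓ²`. -/
theorem partialDeriv_comp_cubicShear_add (hf : ContDiff ℝ ∞ f) (hg : ContDiff ℝ ∞ g)
    (c : Fin n) :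
    partialDeriv c (fun y => f (cubicShear y₀ v ℓ y) + ℓ (y - y₀) ^ 2 * g y) y₀ =
      partialDeriv c f y₀ := by
  have hℓ := contDiff_clm_sub ℓ y₀
  rw [partialDeriv_add (contDiff_comp_cubicShear y₀ v ℓ hf) ((hℓ.pow 2).mul hg)]
  simp only [partialDeriv_sq_mul_self y₀ ℓ hg]
  simp [partialDeriv_comp_cubicShear y₀ v ℓ hf, cubicShear_self]

/-- The second derivatives are changed at `y₀` only by the addition of a multiple of `ℓ²`. -/
theorem partialDeriv_partialDeriv_comp_cubicShear_add (hf : ContDiff ℝ ∞ f)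
    (hg : ContDiff ℝ ∞ g) (c d : Fin n) :
    partialDeriv d
        (partialDeriv c fun y => f (cubicShear y₀ v ℓ y) + ℓ (y - y₀) ^ 2 * g y) y₀ =
      partialDeriv d (partialDeriv c f) y₀ +
        2 * ℓ (EuclideanSpace.single c 1) * ℓ (EuclideanSpace.single d 1) * g y₀ := by
  have hℓ := contDiff_clm_sub ℓ y₀
  have hθ := contDiff_cubicShear y₀ v ℓ
  set h : Model n → ℝ := fun y => 3 * ℓ (EuclideanSpace.single c 1) *
    fderiv ℝ f (cubicShear y₀ v ℓ y) v + partialDeriv c g y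
  have hh : ContDiff ℝ ∞ h := (contDiff_const.mul (((hf.fderiv_right (m := ∞) le_rfl).comp
    hθ).clm_apply contDiff_const)).add (contDiff_partialDeriv hg c)
  have hc : (partialDeriv c fun y => f (cubicShear y₀ v ℓ y) + ℓ (y - y₀) ^ 2 * g y) =
      fun y => (partialDeriv c f (cubicShear y₀ v ℓ y) + ℓ (y - y₀) ^ 2 * h y) +
        ℓ (y - y₀) * (2 * ℓ (EuclideanSpace.single c 1) * g y) := by
    rw [partialDeriv_add (contDiff_comp_cubicShear y₀ v ℓ hf) ((hℓ.pow 2).mul hg),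
      partialDeriv_comp_cubicShear y₀ v ℓ hf, partialDeriv_mul (hℓ.pow 2) hg,
      partialDeriv_clm_sub_sq]
    ext y
    simp only [h]
    ring
  rw [hc, partialDeriv_add ((contDiff_comp_cubicShear y₀ v ℓ (contDiff_partialDeriv hf c)).add
    ((hℓ.pow 2).mul hh)) (hℓ.mul (contDiff_const.mul hg))]
  simp only [partialDeriv_comp_cubicShear_add y₀ v ℓ (contDiff_partialDeriv hf c) hh]
  rw [partialDeriv_mul hℓ (contDiff_const.mul hg), partialDeriv_clm_sub]
  simp
  ring

end PartialDeriv

/-- A smooth map with invertible derivative at `y₀` restricts to a diffeomorphism between open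
sets. -/
theorem exists_openPartialHomeomorph {E : Type*} [NormedAddCommGroup E] [NormedSpace ℝ E]
    [CompleteSpace E] {f : E → E} (hf : ContDiff ℝ ∞ f) (e : E ≃L[ℝ] E) {y₀ : E}
    (h : HasFDerivAt f (e : E →L[ℝ] E) y₀) :
    ∃ Θ : OpenPartialHomeomorph E E, y₀ ∈ Θ.source ∧ (∀ y, Θ y = f y) ∧
      ContDiffOn ℝ ∞ Θ.symm Θ.target := by
  -- The inverse function theorem gives smoothness of the inverse near `f y₀` only; restricting to
  -- the open set where the derivative is invertible gives it on the whole target.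
  set Θ₀ := hf.contDiffAt.toOpenPartialHomeomorph f h (by simp)
  have hW : IsOpen {y | fderiv ℝ f y ∈ Set.range ((↑) : (E ≃L[ℝ] E) → E →L[ℝ] E)} :=
    ContinuousLinearEquiv.isOpen.preimage (hf.continuous_fderiv (by simp))
  have hcoe : ∀ y, Θ₀.restrOpen _ hW y = f y := fun y => rfl
  refine ⟨Θ₀.restrOpen _ hW, ?_, hcoe, fun y hy => ?_⟩
  · rw [OpenPartialHomeomorph.restrOpen_source]
    exact ⟨hf.contDiffAt.mem_toOpenPartialHomeomorph_source h (by simp), e, h.fderiv.symm⟩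
  · have hs := (Θ₀.restrOpen _ hW).map_target hy
    rw [OpenPartialHomeomorph.restrOpen_source] at hs
    obtain ⟨-, e', he'⟩ := hs
    refine ContDiffAt.contDiffWithinAt
      (OpenPartialHomeomorph.contDiffAt_symm _ (f₀' := e') hy ?_ hf.contDiffAt)
    rw [he']
    exact ((hf.differentiable (by simp)) _).hasFDerivAt

/-! ### Invariance under cubic shears -/

section Shear

variable {n : ℕ}

/-- The coordinates at `y` of the 2-jet of a metric with components `G`. -/
def jetOf (G : Model n → Fin n → Fin n → ℝ) (y : Model n) : JetCoord n :=
  (y, G y, fun a b c => partialDeriv c (fun y => G y a b) y,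
    fun a b c d => partialDeriv d (partialDeriv c fun y => G y a b) y)

/-- Globally smooth symmetric components which have the right signature at the point of coordinates
`φ x` are, in the chart `φ`, the components of a local metric around `x`. -/
theorem exists_localMetric {X : Type*} [TopologicalSpace X] [ChartedSpace (Model n) X]
    {r s : ℕ} (hrs : r + s = n) {φ : OpenPartialHomeomorph X (Model n)} (hφ : IsChart φ)
    {x : X} (hx : x ∈ φ.source) {G : Model n → Fin n → Fin n → ℝ}
    (hG : ∀ a b, ContDiff ℝ ∞ fun y => G y a b) (hsymm : ∀ y a b, G y a b = G y b a)
    (hM : IsMetric r s (Matrix.toBilin' (Matrix.of (G (φ x))))) :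
    ∃ g : LocalMetric (n := n) X r s, x ∈ g.domain ∧
      (∀ y ∈ φ.target, g.jetCoord φ y = jetOf G y) ∧
      ∀ z v w, g.form z v w = Matrix.toBilin' (Matrix.of (G (φ z)))
        (fun j => coordCovector φ z j v) (fun j => coordCovector φ z j w) := by
  have hev := eventually_isMetric hrs (fun a b => (hG a b).continuous) hsymm hM
  set U := {y | IsMetric r s (Matrix.toBilin' (Matrix.of (G y)))}
  have hU : ∀ y ∈ interior U, IsMetric r s (Matrix.toBilin' (Matrix.of (G y))) :=
    fun y hy => (interior_subset hy : y ∈ U)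
  refine ⟨LocalMetric.ofComponents hφ isOpen_interior (fun a b => (hG a b).contDiffOn) hU,
    ⟨hx, mem_interior_iff_mem_nhds.mpr hev⟩, fun y hy => ?_,
    fun z v w => rfl⟩
  rw [LocalMetric.jetCoord, LocalMetric.coord₀_ofComponents _ _ _ _ hy,
    LocalMetric.coord₁_ofComponents _ _ _ _ hy, LocalMetric.coord₂_ofComponents _ _ _ _ hy]
  rfl

variable (y₀ v : Model n) (ℓ : Model n →L[ℝ] ℝ) (G : Model n → Fin n → Fin n → ℝ)

/-- The derivative of `cubicShear` at `y`, in coordinates. -/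
def shearDeriv (y : Model n) : (Fin n → ℝ) →ₗ[ℝ] (Fin n → ℝ) :=
  LinearMap.id + ((3 * ℓ (y - y₀) ^ 2) •
    ∑ a, ℓ (EuclideanSpace.single a 1) • LinearMap.proj (R := ℝ) (φ := fun _ : Fin n => ℝ) a
    ).smulRight v.ofLp

/-- The coefficient of `ℓ²` in the components of the pullback of a metric by `cubicShear`. -/
def shearTerm (y : Model n) (a b : Fin n) : ℝ :=
  3 * ℓ (EuclideanSpace.single a 1) * ∑ e, v e * G (cubicShear y₀ v ℓ y) e b +
  3 * ℓ (EuclideanSpace.single b 1) * ∑ f, v f * G (cubicShear y₀ v ℓ y) a f +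
  9 * ℓ (y - y₀) ^ 2 * ℓ (EuclideanSpace.single a 1) * ℓ (EuclideanSpace.single b 1) *
    ∑ e, ∑ f, v e * v f * G (cubicShear y₀ v ℓ y) e f

/-- The components of the pullback of a metric by `cubicShear`. -/
def shearPullback (y : Model n) (a b : Fin n) : ℝ :=
  G (cubicShear y₀ v ℓ y) a b + ℓ (y - y₀) ^ 2 * shearTerm y₀ v ℓ G y a b

variable {G}

theorem contDiff_shearTerm (hG : ∀ a b, ContDiff ℝ ∞ fun y => G y a b) (a b : Fin n) :
    ContDiff ℝ ∞ fun y => shearTerm y₀ v ℓ G y a b := by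
  have h := fun a b => contDiff_comp_cubicShear y₀ v ℓ (hG a b)
  have hℓ := contDiff_clm_sub ℓ y₀
  exact ((contDiff_const.mul (ContDiff.sum fun e _ => contDiff_const.mul (h e b))).add
    (contDiff_const.mul (ContDiff.sum fun f _ => contDiff_const.mul (h a f)))).add
    ((((contDiff_const.mul (hℓ.pow 2)).mul contDiff_const).mul contDiff_const).mul
      (ContDiff.sum fun e _ => ContDiff.sum fun f _ => contDiff_const.mul (h e f)))

theorem contDiff_shearPullback (hG : ∀ a b, ContDiff ℝ ∞ fun y => G y a b) (a b : Fin n) :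
    ContDiff ℝ ∞ fun y => shearPullback y₀ v ℓ G y a b :=
  (contDiff_comp_cubicShear y₀ v ℓ (hG a b)).add
    (((contDiff_clm_sub ℓ y₀).pow 2).mul (contDiff_shearTerm y₀ v ℓ hG a b))

theorem shearPullback_symm (hsymm : ∀ y a b, G y a b = G y b a) (y : Model n) (a b : Fin n) :
    shearPullback y₀ v ℓ G y a b = shearPullback y₀ v ℓ G y b a := by
  simp only [shearPullback, shearTerm, hsymm _ a, hsymm _ _ b]
  ring

theorem shearPullback_self : shearPullback y₀ v ℓ G y₀ = G y₀ := by
  ext a b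
  simp [shearPullback, cubicShear_self]

theorem toBilin'_shearPullback (y : Model n) :
    Matrix.toBilin' (Matrix.of (shearPullback y₀ v ℓ G y)) =
      LinearMap.compl₁₂ (Matrix.toBilin' (Matrix.of (G (cubicShear y₀ v ℓ y))))
        (shearDeriv y₀ v ℓ y) (shearDeriv y₀ v ℓ y) := by
  refine LinearMap.BilinForm.toMatrix'.injective ?_
  rw [LinearMap.BilinForm.toMatrix'_toBilin']
  ext a b
  have hd : ∀ a, shearDeriv y₀ v ℓ y (Pi.single a 1) =
      Pi.single a 1 + (3 * ℓ (y - y₀) ^ 2 * ℓ (EuclideanSpace.single a 1)) • v.ofLp := by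
    intro a
    simp [shearDeriv, Pi.single_apply]
  have hB : ∀ u w : Fin n → ℝ, Matrix.toBilin' (Matrix.of (G (cubicShear y₀ v ℓ y))) u w =
      ∑ e, ∑ f, u e * w f * G (cubicShear y₀ v ℓ y) e f := by
    intro u w
    rw [Matrix.toBilin'_apply]
    refine Finset.sum_congr rfl fun e _ => Finset.sum_congr rfl fun f _ => ?_
    rw [Matrix.of_apply]
    ring
  rw [LinearMap.BilinForm.toMatrix'_apply, LinearMap.compl₁₂_apply, hd, hd]
  simp only [map_add, map_smul, LinearMap.add_apply, LinearMap.smul_apply, smul_eq_mul, hB]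
  simp [Pi.single_apply, shearPullback, shearTerm]
  ring

/-- The variation of the second derivatives of a metric under a cubic shear. -/
theorem jetOf_shearPullback (hG : ∀ a b, ContDiff ℝ ∞ fun y => G y a b)
    (hsymm : ∀ y a b, G y a b = G y b a) :
    jetOf (shearPullback y₀ v ℓ G) y₀ = ((jetOf G y₀).1, (jetOf G y₀).2.1, (jetOf G y₀).2.2.1,
      (jetOf G y₀).2.2.2 + (6 : ℝ) • gaugeArray (fun b => ∑ e, v e * G y₀ e b)
        fun a => ℓ (EuclideanSpace.single a 1)) := by
  have h1 : (fun a b c => partialDeriv c (fun y => shearPullback y₀ v ℓ G y a b) y₀) =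
      fun a b c => partialDeriv c (fun y => G y a b) y₀ := by
    ext a b c
    exact partialDeriv_comp_cubicShear_add y₀ v ℓ (hG a b) (contDiff_shearTerm y₀ v ℓ hG a b) c
  simp only [jetOf, shearPullback_self, h1]
  congr 3
  ext a b c d
  refine (partialDeriv_partialDeriv_comp_cubicShear_add y₀ v ℓ (hG a b)
    (contDiff_shearTerm y₀ v ℓ hG a b) c d).trans ?_
  simp only [Pi.add_apply, Pi.smul_apply, gaugeArray, shearTerm, cubicShear_self, sub_self,
    map_zero, smul_eq_mul, hsymm _ a]
  ring

end Shear

section ChartConj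

variable {n : ℕ} {X : Type*} [TopologicalSpace X]

/-- A local diffeomorphism of the model space, transported to the manifold by a chart. -/
def chartConj (φ : OpenPartialHomeomorph X (Model n))
    (Θ : OpenPartialHomeomorph (Model n) (Model n)) : OpenPartialHomeomorph X X :=
  (φ.trans Θ).trans φ.symm

theorem chartConj_symm (φ : OpenPartialHomeomorph X (Model n))
    (Θ : OpenPartialHomeomorph (Model n) (Model n)) :
    (chartConj φ Θ).symm = chartConj φ Θ.symm := by
  simp [chartConj, OpenPartialHomeomorph.trans_symm_eq_symm_trans_symm,
    OpenPartialHomeomorph.trans_assoc]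

end ChartConj

section Naturality

variable {n : ℕ} {X : Type*} [TopologicalSpace X] [ChartedSpace (Model n) X] {r s p : ℕ}
  {φ : OpenPartialHomeomorph X (Model n)}

theorem contMDiffOn_chartConj (hφ : IsChart φ)
    {Θ : OpenPartialHomeomorph (Model n) (Model n)} (hΘ : ContDiffOn ℝ ∞ Θ Θ.source) :
    ContMDiffOn 𝓘(ℝ, Model n) 𝓘(ℝ, Model n) ∞ (chartConj φ Θ) (chartConj φ Θ).source := by
  refine (contMDiffOn_symm_of_mem_maximalAtlas hφ).comp (t := φ.target)
    (hΘ.contMDiffOn.comp (t := Θ.source)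
      ((contMDiffOn_of_mem_maximalAtlas hφ).mono fun z hz => ?_) fun z hz => ?_) fun z hz => ?_
  all_goals
    simp only [chartConj, OpenPartialHomeomorph.trans_source, OpenPartialHomeomorph.symm_source,
      Set.mem_inter_iff, Set.mem_preimage, OpenPartialHomeomorph.coe_trans, Function.comp_apply]
      at hz
  · exact hz.1.1
  · exact hz.1.2
  · exact hz.2

/-- The derivative of a cubic shear transported by `φ`, in the coordinates given by `φ`. -/
theorem coordCovector_chartConj (hφ : IsChart φ) {y₀ v : Model n} {ℓ : Model n →L[ℝ] ℝ}
    {Θ : OpenPartialHomeomorph (Model n) (Model n)} (hΘ : ∀ y, Θ y = cubicShear y₀ v ℓ y)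
    {z : X} (hz : z ∈ (chartConj φ Θ).source) (w : TangentSpace 𝓘(ℝ, Model n) z) (j : Fin n) :
    coordCovector φ (chartConj φ Θ z) j
        (mfderiv 𝓘(ℝ, Model n) 𝓘(ℝ, Model n) (chartConj φ Θ) z w) =
      shearDeriv y₀ v ℓ (φ z) (fun j => coordCovector φ z j w) j := by
  have hτ : MDifferentiableAt 𝓘(ℝ, Model n) 𝓘(ℝ, Model n) (chartConj φ Θ) z := by
    refine ((contMDiffOn_chartConj hφ ?_).mdifferentiableOn (by simp)).mdifferentiableAt
      ((chartConj φ Θ).open_source.mem_nhds hz)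
    rw [show (Θ : Model n → Model n) = cubicShear y₀ v ℓ from funext hΘ]
    exact (contDiff_cubicShear y₀ v ℓ).contDiffOn
  have hsrc := hz
  simp only [chartConj, OpenPartialHomeomorph.trans_source, OpenPartialHomeomorph.symm_source,
    Set.mem_inter_iff, Set.mem_preimage, OpenPartialHomeomorph.coe_trans, Function.comp_apply]
    at hsrc
  have hφ1 : MDifferentiableAt 𝓘(ℝ, Model n) 𝓘(ℝ, Model n) φ (chartConj φ Θ z) :=
    hφ.mdifferentiable.mdifferentiableAt (φ.map_target hsrc.2)
  have hφ2 : MDifferentiableAt 𝓘(ℝ, Model n) 𝓘(ℝ, Model n) φ z :=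
    hφ.mdifferentiable.mdifferentiableAt hsrc.1.1
  have hθ := (hasFDerivAt_cubicShear y₀ v ℓ (φ z)).hasMFDerivAt
  have hev : φ ∘ chartConj φ Θ =ᶠ[𝓝 z] cubicShear y₀ v ℓ ∘ φ := by
    filter_upwards [(chartConj φ Θ).open_source.mem_nhds hz] with z' hz'
    simp only [chartConj, OpenPartialHomeomorph.trans_source, OpenPartialHomeomorph.symm_source,
      Set.mem_inter_iff, Set.mem_preimage, OpenPartialHomeomorph.coe_trans,
      Function.comp_apply] at hz' ⊢
    rw [φ.right_inv hz'.2, hΘ]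
  have h1 := mfderiv_comp z hφ1 hτ
  have h2 := (hθ.comp z hφ2.hasMFDerivAt).mfderiv
  have h3 := hev.mfderiv_eq (I := 𝓘(ℝ, Model n)) (I' := 𝓘(ℝ, Model n))
  rw [h1, h2] at h3
  have h4 := congrArg (fun L : Model n →L[ℝ] Model n => (L w) j) h3
  refine h4.trans ?_
  change ((ContinuousLinearMap.id ℝ (Model n) + ((3 * ℓ (φ z - y₀) ^ 2) • ℓ).smulRight v)
    (mfderiv 𝓘(ℝ, Model n) 𝓘(ℝ, Model n) φ z w : Model n)) j = _
  set u : Model n := mfderiv 𝓘(ℝ, Model n) 𝓘(ℝ, Model n) φ z w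
  have hu : (fun j => coordCovector φ z j w) = u.ofLp := rfl
  have hℓ : ℓ u = ∑ a, ℓ (EuclideanSpace.single a 1) * u a := by
    conv_lhs => rw [← (EuclideanSpace.basisFun (Fin n) ℝ).sum_repr u]
    simp [mul_comm]
  rw [hu]
  simp [shearDeriv, hℓ]

/-- Naturality of `T` under the diffeomorphism which is, in the chart `φ`, a cubic shear at
`φ x`. -/
theorem SecondOrderTensor.IsNatural.apply_jetOf_shearPullback
    {T : SecondOrderTensor (n := n) X r s p} (hT : T.IsNatural) (hrs : r + s = n)
    (hφ : IsChart φ) {J : Fin p → Fin n} {F : JetCoord n → ℝ}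
    (hF : ∀ x ∈ φ.source, ∀ (g : LocalMetric X r s) (hx : x ∈ g.domain),
      tensorComponent (T.toFun x (g.jet₂ x hx)) φ J = F (g.jetCoord φ (φ x)))
    {x : X} (hx : x ∈ φ.source) {G : Model n → Fin n → Fin n → ℝ}
    (hG : ∀ a b, ContDiff ℝ ∞ fun y => G y a b) (hsymm : ∀ y a b, G y a b = G y b a)
    (hM : IsMetric r s (Matrix.toBilin' (Matrix.of (G (φ x)))))
    (v : Model n) (ℓ : Model n →L[ℝ] ℝ) :
    F (jetOf (shearPullback (φ x) v ℓ G) (φ x)) = F (jetOf G (φ x)) := by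
  obtain ⟨Θ, hxΘ, hΘ, hΘsymm⟩ := exists_openPartialHomeomorph
    (contDiff_cubicShear (φ x) v ℓ) (ContinuousLinearEquiv.refl ℝ _) (y₀ := φ x) (by
      have h := hasFDerivAt_cubicShear (φ x) v ℓ (φ x)
      have he : ContinuousLinearMap.id ℝ (Model n) +
          ((3 * ℓ (φ x - φ x) ^ 2) • ℓ).smulRight v = ContinuousLinearEquiv.refl ℝ (Model n) := by
        ext w
        simp
      rwa [he] at h)
  have hΘx : Θ (φ x) = φ x := by rw [hΘ, cubicShear_self]
  have hτx : chartConj φ Θ x = x := by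
    simp [chartConj, hΘx, φ.left_inv hx]
  have hxτ : x ∈ (chartConj φ Θ).source := by
    simp [chartConj, hx, hxΘ, hΘx, φ.map_source hx]
  have hΘd : ContDiffOn ℝ ∞ Θ Θ.source := by
    rw [show (Θ : Model n → Model n) = cubicShear (φ x) v ℓ from funext hΘ]
    exact (contDiff_cubicShear (φ x) v ℓ).contDiffOn
  obtain ⟨g, hgx, hgjet, hgform⟩ := exists_localMetric hrs hφ hx
    (contDiff_shearPullback (φ x) v ℓ hG) (shearPullback_symm (φ x) v ℓ hsymm)
    (by rwa [shearPullback_self])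
  obtain ⟨g', hgx', hgjet', hgform'⟩ := exists_localMetric hrs hφ hx hG hsymm hM
  have hnat := hT (chartConj φ Θ) (contMDiffOn_chartConj hφ hΘd) (by
      have h := contMDiffOn_chartConj hφ (Θ := Θ.symm) hΘsymm
      rwa [← chartConj_symm] at h) g g' x hgx (by rwa [hτx]) hxτ (by
    filter_upwards [(chartConj φ Θ).open_source.mem_nhds hxτ] with z hz w w'
    rw [hgform, hgform', toBilin'_shearPullback, LinearMap.compl₁₂_apply]
    have hz' : φ (chartConj φ Θ z) = cubicShear (φ x) v ℓ (φ z) := by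
      simp only [chartConj, OpenPartialHomeomorph.trans_source, OpenPartialHomeomorph.symm_source,
        Set.mem_inter_iff, Set.mem_preimage, OpenPartialHomeomorph.coe_trans,
        Function.comp_apply] at hz ⊢
      rw [φ.right_inv hz.2, hΘ]
    rw [hz']
    simp only [coordCovector_chartConj hφ hΘ hz])
  have hcov : ∀ j, (mfderiv 𝓘(ℝ, Model n) 𝓘(ℝ, Model n) (chartConj φ Θ) x).toLinearMap.dualMap
      (coordCovector φ (chartConj φ Θ x) j) = coordCovector φ x j := by
    intro j
    ext w
    have := coordCovector_chartConj hφ hΘ hxτ w j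
    rw [LinearMap.dualMap_apply]
    refine this.trans ?_
    simp [shearDeriv]
  have h1 := congrArg (fun S => tensorComponent S φ J) hnat
  have h2 : ∀ S : Tensor (Fin p) (TangentSpace 𝓘(ℝ, Model n) x),
      tensorComponent (Tensor.push
        (mfderiv 𝓘(ℝ, Model n) 𝓘(ℝ, Model n) (chartConj φ Θ) x).toLinearMap S) φ J =
      tensorComponent S φ J := by
    intro S
    simp only [tensorComponent, Tensor.push, MultilinearMap.compLinearMap_apply, hcov]
  simp only [h2] at h1
  rw [hF _ (by rwa [hτx]), hF _ hx, hτx, hgjet _ (φ.map_source hx),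
    hgjet' _ (φ.map_source hx)] at h1
  exact h1.symm

end Naturality

/-! ### The divergence and third derivatives of the metric -/

section Divergence

variable {n : ℕ}

theorem exists_hasFDerivAt_jetOf {G : Model n → Fin n → Fin n → ℝ}
    (hG : ∀ a b, ContDiff ℝ ∞ fun y => G y a b) (y : Model n) :
    ∃ L : Model n →L[ℝ] JetCoord n, HasFDerivAt (jetOf G) L y ∧
      ∀ k, L (EuclideanSpace.single k 1) = (EuclideanSpace.single k 1,
        fun a b => partialDeriv k (fun y => G y a b) y,
        fun a b c => partialDeriv k (partialDeriv c fun y => G y a b) y,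
        fun a b c d => partialDeriv k (partialDeriv d (partialDeriv c fun y => G y a b)) y) := by
  have hd : ∀ {f : Model n → ℝ}, ContDiff ℝ ∞ f → HasFDerivAt f (fderiv ℝ f y) y :=
    fun hf => (hf.differentiable (by simp) y).hasFDerivAt
  refine ⟨_, (hasFDerivAt_id y).prodMk
    ((hasFDerivAt_pi.mpr fun a => hasFDerivAt_pi.mpr fun b => hd (hG a b)).prodMk
    ((hasFDerivAt_pi.mpr fun a => hasFDerivAt_pi.mpr fun b => hasFDerivAt_pi.mpr fun c =>
      hd (contDiff_partialDeriv (hG a b) c)).prodMk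
    (hasFDerivAt_pi.mpr fun a => hasFDerivAt_pi.mpr fun b => hasFDerivAt_pi.mpr fun c =>
      hasFDerivAt_pi.mpr fun d =>
        hd (contDiff_partialDeriv (contDiff_partialDeriv (hG a b) c) d)))), fun k => rfl⟩

/-- Addition of a cubic term to the components of a metric. -/
def addCubic (G : Model n → Fin n → Fin n → ℝ) (y₀ : Model n) (μ : Fin n → ℝ)
    (ℓ : Model n →L[ℝ] ℝ) (y : Model n) (a b : Fin n) : ℝ :=
  G y a b + μ a * μ b / 6 * ℓ (y - y₀) ^ 3

variable {G : Model n → Fin n → Fin n → ℝ} (y₀ : Model n) (μ : Fin n → ℝ) (ℓ : Model n →L[ℝ] ℝ)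

theorem contDiff_addCubic (hG : ∀ a b, ContDiff ℝ ∞ fun y => G y a b) (a b : Fin n) :
    ContDiff ℝ ∞ fun y => addCubic G y₀ μ ℓ y a b :=
  (hG a b).add (contDiff_const.mul ((contDiff_clm_sub ℓ y₀).pow 3))

theorem partialDeriv_addCubic (hG : ∀ a b, ContDiff ℝ ∞ fun y => G y a b) (a b c : Fin n) :
    partialDeriv c (fun y => addCubic G y₀ μ ℓ y a b) = fun y =>
      partialDeriv c (fun y => G y a b) y +
        μ a * μ b / 2 * ℓ (EuclideanSpace.single c 1) * ℓ (y - y₀) ^ 2 := by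
  have hℓ := contDiff_clm_sub ℓ y₀
  unfold addCubic
  rw [partialDeriv_add (hG a b) (contDiff_const.mul (hℓ.pow 3)),
    partialDeriv_const_mul (hℓ.pow 3), partialDeriv_clm_sub_cube]
  ext y
  ring

theorem partialDeriv₂_addCubic (hG : ∀ a b, ContDiff ℝ ∞ fun y => G y a b) (a b c d : Fin n) :
    partialDeriv d (partialDeriv c fun y => addCubic G y₀ μ ℓ y a b) = fun y =>
      partialDeriv d (partialDeriv c fun y => G y a b) y +
        μ a * μ b * ℓ (EuclideanSpace.single c 1) * ℓ (EuclideanSpace.single d 1) *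
          ℓ (y - y₀) := by
  have hℓ := contDiff_clm_sub ℓ y₀
  rw [partialDeriv_addCubic y₀ μ ℓ hG, partialDeriv_add (contDiff_partialDeriv (hG a b) c)
    (contDiff_const.mul (hℓ.pow 2)), partialDeriv_const_mul (hℓ.pow 2), partialDeriv_clm_sub_sq]
  ext y
  ring

theorem partialDeriv₃_addCubic (hG : ∀ a b, ContDiff ℝ ∞ fun y => G y a b)
    (a b c d k : Fin n) (y : Model n) :
    partialDeriv k (partialDeriv d (partialDeriv c fun y => addCubic G y₀ μ ℓ y a b)) y =
      partialDeriv k (partialDeriv d (partialDeriv c fun y => G y a b)) y +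
        ℓ (EuclideanSpace.single k 1) *
          squareArray μ (fun a => ℓ (EuclideanSpace.single a 1)) a b c d := by
  have hℓ := contDiff_clm_sub ℓ y₀
  rw [partialDeriv₂_addCubic y₀ μ ℓ hG, partialDeriv_add
    (contDiff_partialDeriv (contDiff_partialDeriv (hG a b) c) d)
    (contDiff_const.mul hℓ), partialDeriv_const_mul hℓ, partialDeriv_clm_sub]
  simp only [squareArray]
  ring

theorem jetOf_addCubic_self (hG : ∀ a b, ContDiff ℝ ∞ fun y => G y a b) :
    jetOf (addCubic G y₀ μ ℓ) y₀ = jetOf G y₀ := by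
  have h₀ : addCubic G y₀ μ ℓ y₀ = G y₀ := by
    ext a b
    simp [addCubic]
  have h₁ : (fun a b c => partialDeriv c (fun y => addCubic G y₀ μ ℓ y a b) y₀) =
      fun a b c => partialDeriv c (fun y => G y a b) y₀ := by
    ext a b c
    rw [partialDeriv_addCubic y₀ μ ℓ hG]
    simp
  have h₂ : (fun a b c d => partialDeriv d (partialDeriv c fun y => addCubic G y₀ μ ℓ y a b) y₀) =
      fun a b c d => partialDeriv d (partialDeriv c fun y => G y a b) y₀ := by
    ext a b c d
    rw [partialDeriv₂_addCubic y₀ μ ℓ hG]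
    simp
  simp only [jetOf, h₀, h₁, h₂]

variable {X : Type*} [TopologicalSpace X] [ChartedSpace (Model n) X] {r s q : ℕ}
  {φ : OpenPartialHomeomorph X (Model n)}

/-- The Christoffel symbols as functions of the coordinates of a 2-jet. -/
def jetChristoffel (z : JetCoord n) (i j k : Fin n) : ℝ :=
  (1 / 2) * ∑ l, (Matrix.of z.2.1)⁻¹ i l * (z.2.2.1 l k j + z.2.2.1 l j k - z.2.2.1 j k l)

/-- The divergence of `T(g)` as a function of the 2-jet `z` of `g` and of its derivatives `W k`.
Although `jetCoordSet` is not open in the space of all coordinates, any derivative of `F J` within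
it, such as `fderivWithin`, computes the derivatives of `F J` along curves contained in it. -/
def jetDivergence (r s : ℕ) (φ : OpenPartialHomeomorph X (Model n))
    (F : (Fin (q + 1) → Fin n) → JetCoord n → ℝ) (J : Fin q → Fin n) (z : JetCoord n)
    (W : Fin n → JetCoord n) : ℝ :=
  ∑ k, (fderivWithin ℝ (F (Fin.snoc J k)) (jetCoordSet r s φ) z (W k) +
    ∑ i, ∑ l, jetChristoffel z ((Fin.snoc J k : Fin (q + 1) → Fin n) i) k l *
      F (Function.update (Fin.snoc J k) i l) z)

theorem SecondOrderTensor.divergence_eq_jetDivergence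
    {T : SecondOrderTensor (n := n) X r s (q + 1)}
    (hφ : IsChart φ) {F : (Fin (q + 1) → Fin n) → JetCoord n → ℝ}
    (hFs : ∀ J, ContDiffOn ℝ ∞ (F J) (jetCoordSet r s φ))
    (hF : ∀ J, ∀ x ∈ φ.source, ∀ (g : LocalMetric X r s) (hx : x ∈ g.domain),
      tensorComponent (T.toFun x (g.jet₂ x hx)) φ J = F J (g.jetCoord φ (φ x)))
    {x : X} (hx : x ∈ φ.source) (g : LocalMetric (n := n) X r s) (hg : x ∈ g.domain)
    {G : Model n → Fin n → Fin n → ℝ} (hgG : ∀ y ∈ φ.target, g.jetCoord φ y = jetOf G y)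
    {L : Model n →L[ℝ] JetCoord n} (hL : HasFDerivAt (jetOf G) L (φ x)) (J : Fin q → Fin n) :
    T.divergence g φ J (φ x) =
      jetDivergence r s φ F J (jetOf G (φ x)) fun k => L (EuclideanSpace.single k 1) := by
  have hopen : IsOpen (φ.target ∩ φ.symm ⁻¹' g.domain) :=
    φ.symm.isOpen_inter_preimage g.isOpen_domain
  have hmem : φ.target ∩ φ.symm ⁻¹' g.domain ∈ 𝓝 (φ x) :=
    hopen.mem_nhds ⟨φ.map_source hx, by simpa [φ.left_inv hx] using hg⟩
  have hfield : ∀ J, ∀ y ∈ φ.target ∩ φ.symm ⁻¹' g.domain,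
      T.fieldComponent g φ J y = F J (jetOf G y) := by
    intro J y hy
    rw [SecondOrderTensor.fieldComponent, dif_pos (show φ.symm y ∈ g.domain from hy.2),
      hF J _ (φ.map_target hy.1), φ.right_inv hy.1, hgG y hy.1]
  have hmaps : Set.MapsTo (jetOf G) (φ.target ∩ φ.symm ⁻¹' g.domain) (jetCoordSet r s φ) := by
    intro y hy
    rw [← hgG y hy.1]
    exact g.jetCoord_mem hφ hy.1 hy.2
  have hpd : ∀ J k, partialDeriv k (T.fieldComponent g φ J) (φ x) =
      fderivWithin ℝ (F J) (jetCoordSet r s φ) (jetOf G (φ x))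
        (L (EuclideanSpace.single k 1)) := by
    intro J k
    have h1 : T.fieldComponent g φ J =ᶠ[𝓝 (φ x)] fun y => F J (jetOf G y) := by
      filter_upwards [hmem] with y hy
      exact hfield J y hy
    have h2 : HasFDerivWithinAt (F J)
        (fderivWithin ℝ (F J) (jetCoordSet r s φ) (jetOf G (φ x)))
        (jetCoordSet r s φ) (jetOf G (φ x)) :=
      (((hFs J).differentiableOn (by simp)) _
        (hmaps (mem_of_mem_nhds hmem))).hasFDerivWithinAt
    have h3 := (h2.comp (φ x) hL.hasFDerivWithinAt hmaps).hasFDerivAt hmem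
    rw [partialDeriv_congr h1]
    exact congrArg (fun M => M (EuclideanSpace.single k 1)) h3.fderiv
  have hchr : ∀ i j k, g.christoffel φ (φ x) i j k = jetChristoffel (jetOf G (φ x)) i j k := by
    intro i j k
    rw [← hgG _ (φ.map_source hx)]
    rfl
  simp only [SecondOrderTensor.divergence, LocalMetric.covDeriv, jetDivergence, hpd, hchr,
    fun J => hfield J _ (mem_of_mem_nhds hmem)]

/-- The part of the divergence containing the third derivatives of the metric: two metrics with
the same 2-jet at a point, whose third derivatives differ by `μ_a μ_b ℓ_c ℓ_d ℓ_k`, are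
compared. -/
theorem SecondOrderTensor.IsDivergenceFree.sum_fderivWithin_eq_zero
    {T : SecondOrderTensor (n := n) X r s (q + 1)} (hT : T.IsDivergenceFree) (hrs : r + s = n)
    (hφ : IsChart φ) {F : (Fin (q + 1) → Fin n) → JetCoord n → ℝ}
    (hFs : ∀ J, ContDiffOn ℝ ∞ (F J) (jetCoordSet r s φ))
    (hF : ∀ J, ∀ x ∈ φ.source, ∀ (g : LocalMetric X r s) (hx : x ∈ g.domain),
      tensorComponent (T.toFun x (g.jet₂ x hx)) φ J = F J (g.jetCoord φ (φ x)))
    {x : X} (hx : x ∈ φ.source)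
    (hG : ∀ a b, ContDiff ℝ ∞ fun y => G y a b) (hsymm : ∀ y a b, G y a b = G y b a)
    (hM : IsMetric r s (Matrix.toBilin' (Matrix.of (G (φ x))))) (J : Fin q → Fin n) :
    ∑ k, ℓ (EuclideanSpace.single k 1) *
      fderivWithin ℝ (F (Fin.snoc J k)) (jetCoordSet r s φ) (jetOf G (φ x))
        (0, 0, 0, squareArray μ fun a => ℓ (EuclideanSpace.single a 1)) = 0 := by
  -- The same linear form `fderivWithin` applies to both metrics, as they have the same 2-jet.
  have hdiv : ∀ {G : Model n → Fin n → Fin n → ℝ} (_ : ∀ a b, ContDiff ℝ ∞ fun y => G y a b)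
      (_ : ∀ y a b, G y a b = G y b a)
      (_ : IsMetric r s (Matrix.toBilin' (Matrix.of (G (φ x)))))
      {L : Model n →L[ℝ] JetCoord n} (_ : HasFDerivAt (jetOf G) L (φ x)),
      jetDivergence r s φ F J (jetOf G (φ x)) (fun k => L (EuclideanSpace.single k 1)) = 0 := by
    intro G hG hsymm hM L hL
    obtain ⟨g, hgx, hgG, -⟩ := exists_localMetric hrs hφ hx hG hsymm hM
    rw [← SecondOrderTensor.divergence_eq_jetDivergence hφ hFs hF hx g hgx hgG hL]
    exact hT φ hφ g x hx hgx J
  obtain ⟨L, hL, hLk⟩ := exists_hasFDerivAt_jetOf hG (φ x)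
  obtain ⟨L', hL', hLk'⟩ := exists_hasFDerivAt_jetOf (contDiff_addCubic (φ x) μ ℓ hG) (φ x)
  have h1 := hdiv hG hsymm hM hL
  have h2 := hdiv (contDiff_addCubic (φ x) μ ℓ hG)
    (fun y a b => by simp only [addCubic, hsymm y a b]; ring)
    (by
      have : addCubic G (φ x) μ ℓ (φ x) = G (φ x) := by
        ext a b
        simp [addCubic]
      rwa [this]) hL'
  have hdiff : ∀ k, L' (EuclideanSpace.single k 1) = L (EuclideanSpace.single k 1) +
      ℓ (EuclideanSpace.single k 1) •
        (0, 0, 0, squareArray μ fun a => ℓ (EuclideanSpace.single a 1)) := by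
    intro k
    rw [hLk, hLk']
    simp only [Prod.smul_mk, Prod.mk_add_mk, smul_zero, add_zero, Prod.mk.injEq, true_and]
    refine ⟨?_, ?_, ?_⟩
    · ext a b
      rw [partialDeriv_addCubic (φ x) μ ℓ hG]
      simp
    · ext a b c
      rw [partialDeriv₂_addCubic (φ x) μ ℓ hG]
      simp
    · ext a b c d
      rw [partialDeriv₃_addCubic (φ x) μ ℓ hG]
      rfl
  rw [jetOf_addCubic_self (φ x) μ ℓ hG] at h2
  have h3 : jetDivergence r s φ F J (jetOf G (φ x)) (fun k => L' (EuclideanSpace.single k 1)) -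
      jetDivergence r s φ F J (jetOf G (φ x)) (fun k => L (EuclideanSpace.single k 1)) =
      ∑ k, ℓ (EuclideanSpace.single k 1) *
        fderivWithin ℝ (F (Fin.snoc J k)) (jetCoordSet r s φ) (jetOf G (φ x))
          (0, 0, 0, squareArray μ fun a => ℓ (EuclideanSpace.single a 1)) := by
    rw [jetDivergence, jetDivergence, ← Finset.sum_sub_distrib]
    refine Finset.sum_congr rfl fun k _ => ?_
    rw [hdiff, map_add, map_smul, smul_eq_mul]
    ring
  rw [← h3, h1, h2, sub_zero]

end Divergence

/-! ### Polynomiality -/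

section Polynomial

variable {n : ℕ}

/-- The covector with given components, as a continuous linear form. -/
def covectorCLM (l : Fin n → ℝ) : Model n →L[ℝ] ℝ :=
  ∑ a, l a • EuclideanSpace.proj (𝕜 := ℝ) a

theorem covectorCLM_single (l : Fin n → ℝ) (k : Fin n) :
    covectorCLM l (EuclideanSpace.single k 1) = l k := by
  simp [covectorCLM]

theorem jetOf_quadraticPoly (y₀ : Model n) (z₀ : Fin n → Fin n → ℝ)
    (z₁ : Fin n → Fin n → Fin n → ℝ) {u : Array₄ n} (hu : ∀ a b c d, u a b c d = u a b d c) :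
    jetOf (fun y a b => quadraticPoly y₀ (z₀ a b) (z₁ a b) (u a b) y) y₀ = (y₀, z₀, z₁, u) := by
  simp only [jetOf, quadraticPoly_self]
  congr 3
  · ext a b c
    simp [partialDeriv_quadraticPoly y₀ (z₀ a b) (z₁ a b) (hu a b)]
  · ext a b c d
    rw [partialDeriv_partialDeriv_quadraticPoly y₀ (z₀ a b) (z₁ a b) (hu a b)]

theorem exists_vecMul_eq {r s : ℕ} {z₀ : Fin n → Fin n → ℝ}
    (h : IsMetric r s (Matrix.toBilin' (Matrix.of z₀))) (μ : Fin n → ℝ) :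
    ∃ v : Model n, (fun b => ∑ e, v e * z₀ e b) = μ := by
  have hdet := LinearMap.BilinForm.nondegenerate_toBilin'_iff_det_ne_zero.mp h.nondegenerate
  refine ⟨WithLp.toLp 2 (Matrix.vecMul μ (Matrix.of z₀)⁻¹), ?_⟩
  have : Matrix.vecMul (Matrix.vecMul μ (Matrix.of z₀)⁻¹) (Matrix.of z₀) = μ := by
    rw [Matrix.vecMul_vecMul, Matrix.nonsing_inv_mul _ (isUnit_iff_ne_zero.mpr hdet),
      Matrix.vecMul_one]
  exact this

/-- The functions `f k` of the arrays `u_{abcd}`, obtained by fixing the 1-jet of the metric and all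
indices of `T` except the last, satisfy the assumptions of `exists_mvPolynomial_of_symmetries`. -/
theorem SecondOrderTensor.isPolynomialOfDegreeLE {X : Type*} [TopologicalSpace X]
    [ChartedSpace (Model n) X] {r s q : ℕ} (hrs : r + s = n)
    {T : SecondOrderTensor (n := n) X r s (q + 1)} (hnat : T.IsNatural)
    (hdiv : T.IsDivergenceFree) : T.IsPolynomialOfDegreeLE (((n : ℝ) - 1) / 2) := by
  intro φ hφ x hx g₀ hg₀ J
  -- For `n = 0` there are no indices `J`, so the negative bound on the degree is harmless.
  have hn : 1 ≤ n := (J 0).pos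
  choose F hFs hF using T.smooth φ hφ
  change ∀ J, ∀ x ∈ φ.source, ∀ (g : LocalMetric X r s) (hx : x ∈ g.domain),
      tensorComponent (T.toFun x (g.jet₂ x hx)) φ J = F J (g.jetCoord φ (φ x)) at hF
  have hjet : ∀ g : LocalMetric (n := n) X r s, x ∈ g.domain →
      g.jetCoord φ (φ x) ∈ jetCoordSet r s φ := fun g hg =>
    g.jetCoord_mem hφ (φ.map_source hx) (by rwa [φ.left_inv hx])
  set z₀ := g₀.coord₀ φ (φ x)
  set z₁ := g₀.coord₁ φ (φ x)
  obtain ⟨hxt, hM, hz₁, -, -⟩ := hjet g₀ hg₀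
  replace hM : IsMetric r s (Matrix.toBilin' (Matrix.of z₀)) := hM
  replace hz₁ : ∀ a b c, z₁ a b c = z₁ b a c := hz₁
  have hs₁ : ∀ (u : Array₄ n) a b c d, symmetrize u a b c d = symmetrize u b a c d := by
    intro u a b c d
    simp only [symmetrize_apply]
    ring
  have hs₂ : ∀ (u : Array₄ n) a b c d, symmetrize u a b c d = symmetrize u a b d c := by
    intro u a b c d
    simp only [symmetrize_apply]
    ring
  have hmem : ∀ u : Array₄ n, ((φ x, z₀, z₁, symmetrize u) : JetCoord n) ∈ jetCoordSet r s φ :=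
    fun u => ⟨hxt, hM, hz₁, hs₁ u, hs₂ u⟩
  -- a metric with 2-jet `(z₀, z₁, symmetrize u)` at `φ x`
  let G : Array₄ n → Model n → Fin n → Fin n → ℝ := fun u y a b =>
    quadraticPoly (φ x) (z₀ a b) (z₁ a b) (symmetrize u a b) y
  have hGs : ∀ u a b, ContDiff ℝ ∞ fun y => G u y a b := fun u a b =>
    contDiff_quadraticPoly _ _ _ _
  have hGsymm : ∀ u y a b, G u y a b = G u y b a := by
    intro u y a b
    simp only [G, hM.symm_apply a b, funext (hz₁ a b), funext fun c => funext (hs₁ u a b c)]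
  have hGjet : ∀ u, jetOf (G u) (φ x) = (φ x, z₀, z₁, symmetrize u) := fun u =>
    jetOf_quadraticPoly (φ x) z₀ z₁ (hs₂ u)
  have hG₀ : ∀ u, G u (φ x) = z₀ := fun u => congrArg (fun z => z.2.1) (hGjet u)
  have hGM : ∀ u, IsMetric r s (Matrix.toBilin' (Matrix.of (G u (φ x)))) := by
    intro u
    rwa [hG₀]
  let ι : Array₄ n →L[ℝ] JetCoord n :=
    LinearMap.toContinuousLinearMap ((LinearMap.inr ℝ (Model n) _).comp
      ((LinearMap.inr ℝ (Fin n → Fin n → ℝ) _).comp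
        ((LinearMap.inr ℝ (Fin n → Fin n → Fin n → ℝ) _).comp symmetrize)))
  have hι : ∀ u, ι u = (0, 0, 0, symmetrize u) := fun u => rfl
  have hι' : ∀ u, ((φ x, z₀, z₁, symmetrize u) : JetCoord n) = (φ x, z₀, z₁, 0) + ι u := by
    intro u
    simp [hι]
  let f : Fin n → Array₄ n → ℝ := fun k u =>
    F (Fin.snoc (Fin.init J) k) (φ x, z₀, z₁, symmetrize u)
  have hf : ∀ k, ContDiff ℝ ∞ (f k) := by
    intro k
    refine (hFs _).comp_contDiff ?_ hmem
    simp only [hι']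
    exact contDiff_const.add ι.contDiff
  have hfd : ∀ k u w, fderiv ℝ (f k) u w = fderivWithin ℝ (F (Fin.snoc (Fin.init J) k))
      (jetCoordSet r s φ) (φ x, z₀, z₁, symmetrize u) (0, 0, 0, symmetrize w) := by
    intro k u w
    have h1 := (((hFs (Fin.snoc (Fin.init J) k)).differentiableOn (by simp)) _
      (hmem u)).hasFDerivWithinAt
    have h2 : HasFDerivAt (fun u => ((φ x, z₀, z₁, symmetrize u) : JetCoord n)) ι u := by
      simp only [hι']
      exact ι.hasFDerivAt.const_add _
    have h3 := (h1.comp u (h2.hasFDerivWithinAt (s := Set.univ)) fun u _ => hmem u).hasFDerivAt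
      Filter.univ_mem
    exact congrArg (fun M => M w) h3.fderiv
  have hgauge : ∀ k u μ l, f k (u + gaugeArray μ l) = f k u := by
    intro k u μ l
    -- A cubic shear along `v` translates the second derivatives by six times the gauge array of
    -- the covector of `v`.
    obtain ⟨v, hv⟩ := exists_vecMul_eq hM ((1 / 6 : ℝ) • μ)
    have := hnat.apply_jetOf_shearPullback hrs hφ
      (hF (Fin.snoc (Fin.init J) k)) hx (hGs u) (hGsymm u) (hGM u) v (covectorCLM l)
    rw [jetOf_shearPullback _ _ _ (hGs u) (hGsymm u), hGjet, hG₀, hv] at this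
    simp only [covectorCLM_single] at this
    have h1 : symmetrize (gaugeArray μ l) = (6 : ℝ) • gaugeArray ((1 / 6 : ℝ) • μ) l := by
      ext a b c d
      simp only [symmetrize_apply, gaugeArray, Pi.smul_apply, smul_eq_mul]
      ring
    simp only [f, map_add, h1]
    exact this
  have hdivf : ∀ u y z, ∑ k, z k * fderiv ℝ (f k) u (squareArray y z) = 0 := by
    intro u y z
    have := hdiv.sum_fderivWithin_eq_zero y (covectorCLM z) hrs hφ hFs hF hx (hGs u) (hGsymm u)
      (hGM u) (Fin.init J)
    simp only [covectorCLM_single, hGjet] at this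
    have h1 : symmetrize (squareArray y z) = squareArray y z := by
      refine symmetrize_eq_self (fun a b c d => ?_) (fun a b c d => ?_) <;>
      · simp only [squareArray]
        ring
    simp only [hfd, h1]
    exact this
  obtain ⟨P, hPdeg, hP⟩ := exists_mvPolynomial_of_symmetries (m := (n - 1) / 2) (by omega) f hf
    (fun k u => by simp only [f, symmetrize_symmetrize]) hgauge hdivf (J (Fin.last q))
  refine ⟨P, ?_, fun g hg h₀ h₁ => ?_⟩
  · calc (P.totalDegree : ℝ) ≤ (((n - 1) / 2 : ℕ) : ℝ) := by exact_mod_cast hPdeg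
      _ ≤ ((n - 1 : ℕ) : ℝ) / 2 := Nat.cast_div_le
      _ = ((n : ℝ) - 1) / 2 := by rw [Nat.cast_sub hn, Nat.cast_one]
  · obtain ⟨-, -, -, h2, h3⟩ := hjet g hg
    have h4 : symmetrize (g.coord₂ φ (φ x)) = g.coord₂ φ (φ x) := symmetrize_eq_self h2 h3
    rw [hF J x hx g hg, LocalMetric.jetCoord, h₀, h₁, ← hP, ← h4]
    simp only [f, Fin.snoc_init_self, symmetrize_symmetrize]

end Polynomial

end NaturalTensors

end

open NaturalTensors in
theorem mainTheorem2 {n : ℕ} {X : Type*} [TopologicalSpace X] [ChartedSpace (Model n) X]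
    [IsManifold 𝓘(ℝ, Model n) ∞ X] (r s : ℕ) (hrs : r + s = n) (q : ℕ) :
    (∀ (x : X) (m : ℕ), 1 ≤ m → (n : ℝ) / 2 ≤ m →
      Div q m (TangentSpace 𝓘(ℝ, Model n) x) = ⊥) ∧
    (∀ T : SecondOrderTensor (n := n) X r s (q + 1), T.IsNatural → T.IsDivergenceFree →
      T.IsPolynomialOfDegreeLE (((n : ℝ) - 1) / 2)) := by
  refine ⟨fun x m _ hm => ?_, fun T hnat hdiv =>
    SecondOrderTensor.isPolynomialOfDegreeLE hrs hnat hdiv⟩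
  have : FiniteDimensional ℝ (TangentSpace 𝓘(ℝ, Model n) x) :=
    inferInstanceAs (FiniteDimensional ℝ (Model n))
  refine Div.eq_bot ?_
  have h1 : Module.finrank ℝ (TangentSpace 𝓘(ℝ, Model n) x) = n :=
    finrank_euclideanSpace_fin (𝕜 := ℝ) (n := n)
  rw [h1]
  have h2 : (n : ℝ) ≤ 2 * m := by linarith
  exact_mod_cast h2
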